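/- **Theorem 3.4 (Uncertainty quantification bounds).** Let $\mathcal X$ be a Polish space and let $(\Omega,\mathcal F,\mathcal F_t,X_t,P^x)$, $x\in\mathcal X$, be a time-homogeneous $\mathcal X$-valued càdlàg Markov process with $X_0=x$ $P^x$-a.s. and with an ergodic invariant probability measure $\mu^*$; write $P^\mu=\int P^x\,d\mu(x)$ and $\mu[f]=\int f\,d\mu$. Let $(A,D(A))$ be the generator of the semigroup $\mathcal P_tg(x)=E^x[g(X_t)]$ on the real Hilbert space $L^2(\mu^*)$, with scalar product $\langle\cdot,\cdot\rangle$ and norm $\|\cdot\|$. Let $\langle\cdot,\cdot\rangle_\#$ be an inner product on $L^2(\mu^*)$, with norm $\|\cdot\|_\#$, such that 1. $c\|g\|\le\|g\|_\#\le C\|g\|$ for all $g\in L^2(\mu^*)$, with constants $0<c\le C<\infty$; 2. $\langle g,1\rangle_\#=\langle g,1\rangle$ for all $g\in L^2(\mu^*)$; 3. for some $\alpha>0$, $\|g\|_\#^2\le\alpha\langle -Ag,g\rangle_\#$ for all $g\in D(A)$ with $\mu^*[g]=0$. For a bounded measurable $f:\mathcal X\to\mathbb R$ put $\widehat f=f-\mu^*[f]$,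 let $M_{\pm\widehat f}$ be the operator of multiplication by $\pm\widehat f$ on $L^2(\mu^*)$ and $M_{\pm\widehat f}^\dagger$ its adjoint with respect to $\langle\cdot,\cdot\rangle_\#$, and set $$v_\pm=2\alpha\left\|\tfrac12\big(M_{\pm\widehat f}+M_{\pm\widehat f}^\dagger\big)1\right\|_\#^2,\qquad b_\pm=\alpha\max\Big\{0,\sup_{\|g\|_\#=1}\langle M_{\pm\widehat f}\,g,g\rangle_\#\Big\}.$$ Let $(\widetilde X_t)_{t\ge0}$ be an $\mathcal X$-valued càdlàg stochastic process (not necessarily Markov) on a probability space with measure $\widetilde P^{\widetilde\mu}$, where $\widetilde\mu$ is the law of $\widetilde X_0$. Denote by $P^\mu_T$ and $\widetilde P^{\widetilde\mu}_T$ the laws of the paths on $[0,T]$, by $R(\cdot\|\cdot)$ the relative entropy, and let $F_T=\frac1T\int_0^Tf(X_t)\,dt$, $\widetilde F_T=\frac1T\int_0^Tf(\widetilde X_t)\,dt$. (a) Let $\mu\ll\mu^*$ be a probability measure with $\|d\mu/d\mu^*\|<\infty$, and let $T>0$ with $R(\widetilde P^{\widetilde\mu}_T\|P^\mu_T)<\infty$.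 Then, for either choice of the sign, $$\pm\left(\widetilde E^{\widetilde\mu}[\widetilde F_T]-E^\mu[F_T]\right)\le\sqrt{2v_\pm\eta_T}+b_\pm\eta_T+\frac Cc\,\frac{1-e^{-T/\alpha}}{T/\alpha}\left\|\frac{d\mu}{d\mu^*}\right\|\sqrt{\operatorname{Var}_{\mu^*}[f]},$$ $$\eta_T=\frac1T\left(\log(c^{-1})+\log\left\|\frac{d\mu}{d\mu^*}\right\|+R\big(\widetilde P^{\widetilde\mu}_T\|P^\mu_T\big)\right).$$ (b) Suppose that the process $(\widetilde X_t,\widetilde P^{\widetilde\mu})$ is ergodic with invariant probability measure $\widetilde\mu^*$, in the sense that $\frac1T\int_0^Th(\widetilde X_t)\,dt\to\widetilde\mu^*[h]$ in probability as $T\to\infty$ for every bounded measurable $h$, and that the limit $\eta_\infty=\lim_{T\to\infty}\frac1TR(\widetilde P^{\widetilde\mu}_T\|P^{\mu^*}_T)$ exists and is finite. Then, for either choice of the sign, $$\pm\left(\widetilde\mu^*[f]-\mu^*[f]\right)\le\sqrt{2v_\pm\eta_\infty}+b_\pm\eta_\infty.$$ -/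

import Mathlib

open MeasureTheory ProbabilityTheory Filter Topology Set
open scoped NNReal ENNReal

namespace HypoUQ

noncomputable section

/-! ### Càdlàg paths, path space, path-space distributions -/

/-- A càdlàg path: right-continuous with left limits at every time of the time set `I`.
At the left end point of `I` the left limit condition is void. -/
def IsCadlag {I E : Type*} [TopologicalSpace I] [Preorder I] [TopologicalSpace E]
    (x : I → E) : Prop :=
  ∀ t, ContinuousWithinAt x (Ici t) t ∧ ∃ l, Tendsto x (𝓝[<] t) (𝓝 l)

/-- The path space `D([0,T], E)` of càdlàg paths on the time window `[0,T]`. -/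
def PathSpace (E : Type*) [TopologicalSpace E] (T : ℝ≥0) : Type _ :=
  {x : Icc (0 : ℝ≥0) T → E // IsCadlag x}

/-- The σ-algebra on `D([0,T], E)` is generated by the evaluations `x ↦ x t`. -/
instance (E : Type*) [TopologicalSpace E] [MeasurableSpace E] (T : ℝ≥0) :
    MeasurableSpace (PathSpace E T) :=
  inferInstanceAs (MeasurableSpace {x : Icc (0 : ℝ≥0) T → E // IsCadlag x})

theorem IsCadlag.restrict {E : Type*} [TopologicalSpace E] {x : ℝ≥0 → E} (hx : IsCadlag x)
    (T : ℝ≥0) : IsCadlag (fun t : Icc (0 : ℝ≥0) T => x t) := by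
  intro t
  obtain ⟨h1, l, h2⟩ := hx t
  have hc : Tendsto (fun u : Icc (0 : ℝ≥0) T => (u : ℝ≥0)) (𝓝 t) (𝓝 (t : ℝ≥0)) :=
    continuous_subtype_val.continuousAt
  refine ⟨?_, l, ?_⟩
  · refine h1.tendsto.comp (tendsto_nhdsWithin_iff.2 ⟨hc.mono_left nhdsWithin_le_nhds, ?_⟩)
    filter_upwards [self_mem_nhdsWithin] with u hu using hu
  · refine h2.comp (tendsto_nhdsWithin_iff.2 ⟨hc.mono_left nhdsWithin_le_nhds, ?_⟩)
    filter_upwards [self_mem_nhdsWithin] with u hu using hu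

/-- The trajectory of a càdlàg process up to time `T`, as an element of path space. -/
def pathMap {Ω E : Type*} [TopologicalSpace E] (X : ℝ≥0 → Ω → E)
    (hX : ∀ ω, IsCadlag (fun t => X t ω)) (T : ℝ≥0) (ω : Ω) : PathSpace E T :=
  ⟨fun t => X t ω, (hX ω).restrict T⟩

theorem measurable_pathMap {Ω E : Type*} [MeasurableSpace Ω] [TopologicalSpace E]
    [MeasurableSpace E] (X : ℝ≥0 → Ω → E) (hX : ∀ ω, IsCadlag (fun t => X t ω))
    (hm : ∀ t, Measurable (X t)) (T : ℝ≥0) : Measurable (pathMap X hX T) := by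
  have h : Measurable (fun ω => fun t : Icc (0 : ℝ≥0) T => X t ω) :=
    measurable_pi_lambda _ fun t => hm t
  exact h.subtype_mk (h := fun ω => (hX ω).restrict T)

/-- The path-space distribution on `[0,T]` of a càdlàg process `X` under the measure `P`. -/
def pathLaw {Ω E : Type*} [MeasurableSpace Ω] [TopologicalSpace E] [MeasurableSpace E]
    (P : Measure Ω) (X : ℝ≥0 → Ω → E) (hX : ∀ ω, IsCadlag (fun t => X t ω)) (T : ℝ≥0) :
    Measure (PathSpace E T) :=
  P.map (pathMap X hX T)

/-- The time average `(1/T) ∫₀ᵀ f(X_t) dt`. -/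
def timeAverage {Ω E : Type*} (X : ℝ≥0 → Ω → E) (f : E → ℝ) (T : ℝ≥0) (ω : Ω) : ℝ :=
  (1 / (T : ℝ)) * ∫ t in (0 : ℝ)..T, f (X t.toNNReal ω)

/-! ### Markov processes -/

/-- A time-homogeneous càdlàg Markov process `(Ω, 𝓕, 𝓕_t, X_t, P^x)`, `x ∈ E`. -/
structure MarkovProcess (Ω E : Type*) [mΩ : MeasurableSpace Ω] [TopologicalSpace E]
    [MeasurableSpace E] where
  /-- the filtration `𝓕_t` -/
  filtration : Filtration ℝ≥0 mΩ
  /-- the process `X_t` -/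
  X : ℝ≥0 → Ω → E
  /-- the family of probability measures `P^x` -/
  P : Kernel E Ω
  isMarkovKernel : IsMarkovKernel P
  adapted : ∀ t, Measurable[filtration t] (X t)
  cadlag : ∀ ω, IsCadlag (fun t => X t ω)
  initial : ∀ x, (P x).map (X 0) = Measure.dirac x
  /-- the Markov property `P^x(X_{s+t} ∈ B | 𝓕_s) = P^{X_s}(X_t ∈ B)` -/
  markov : ∀ (x : E) (s t : ℝ≥0) (B : Set E), MeasurableSet B →
    (P x)[(X (s + t) ⁻¹' B).indicator (fun _ => (1 : ℝ)) | filtration s]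
      =ᵐ[P x] fun ω => (P (X s ω)).real (X t ⁻¹' B)

namespace MarkovProcess

variable {Ω E : Type*} [MeasurableSpace Ω] [TopologicalSpace E] [MeasurableSpace E]

/-- `P^μ = ∫ P^x dμ(x)`. -/
def law (M : MarkovProcess Ω E) (μ : Measure E) : Measure Ω := μ.bind M.P

/-- The semigroup `𝓟_t g(x) = E^x[g(X_t)]`. -/
def semigroup (M : MarkovProcess Ω E) (t : ℝ≥0) (g : E → ℝ) (x : E) : ℝ :=
  ∫ ω, g (M.X t ω) ∂(M.P x)

/-- `μs` is invariant: `X_0 ∼ μs` implies `X_t ∼ μs` for all `t`. -/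
def IsInvariant (M : MarkovProcess Ω E) (μs : Measure E) : Prop :=
  ∀ t, (M.law μs).map (M.X t) = μs

/-- `μs` is an ergodic invariant measure: it is invariant and every set `B` with
`𝓟_t 1_B = 1_B` `μs`-a.e. for all `t` has measure `0` or `1`. -/
def IsErgodicMeasure (M : MarkovProcess Ω E) (μs : Measure E) : Prop :=
  M.IsInvariant μs ∧ ∀ B, MeasurableSet B →
    (∀ t, M.semigroup t (B.indicator fun _ => 1) =ᵐ[μs] B.indicator fun _ => 1) →
    μs B = 0 ∨ μs B = 1

/-- The graph of the generator `(A, D(A))` of the semigroup `𝓟_t` on `L²(μs)`: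
`M.Generates μs g h` says that `g ∈ D(A)` and `A g = h`, that is,
`(𝓟_t g - g) / t → h` in `L²(μs)` as `t ↓ 0`. -/
def Generates (M : MarkovProcess Ω E) (μs : Measure E) (g h : Lp ℝ 2 μs) : Prop :=
  Tendsto (fun t : ℝ≥0 => eLpNorm (fun x => (M.semigroup t g x - g x) / (t : ℝ) - h x) 2 μs)
    (𝓝[>] 0) (𝓝 0)

end MarkovProcess

/-- The process `X` on `(Ω, P)` is ergodic with invariant measure `ν`: time averages of bounded
measurable observables obey the law of large numbers with limit `ν[f]`. The convergence is only
required in probability, which is weaker than almost sure convergence (and is what Birkhoff's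
theorem gives for a stationary ergodic process with one-time marginal `ν`); neither the Markov
property nor stationarity of `X` is assumed. -/
def IsErgodicProcess {Ω E : Type*} [MeasurableSpace Ω] [MeasurableSpace E]
    (P : Measure Ω) (X : ℝ≥0 → Ω → E) (ν : Measure E) : Prop :=
  ∀ f : E → ℝ, Measurable f → (∃ K, ∀ x, |f x| ≤ K) →
    TendstoInMeasure P (fun T : ℝ≥0 => timeAverage X f T) atTop (fun _ => ∫ x, f x ∂ν)

/-! ### Modified inner products on `L²(μs)` -/

section InnerProduct

variable {E : Type*} [MeasurableSpace E] {μs : Measure E}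

/-- The norm `‖g‖_#` of an inner product on `L²(μs)`. -/
def normSharp (ip : InnerProductSpace.Core ℝ (Lp ℝ 2 μs)) (g : Lp ℝ 2 μs) : ℝ :=
  √(ip.inner g g)

/-- The adjoint of `N` with respect to the inner product `ip`, i.e. the operator `N†` with
`⟨N g, k⟩_# = ⟨g, N† k⟩_#` (with value `0` if there is none; see `adjoint_spec`). -/
def adjoint (ip : InnerProductSpace.Core ℝ (Lp ℝ 2 μs)) (N : Lp ℝ 2 μs →L[ℝ] Lp ℝ 2 μs) :
    Lp ℝ 2 μs →ₗ[ℝ] Lp ℝ 2 μs :=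
  open Classical in
  if h : ∃ N' : Lp ℝ 2 μs →ₗ[ℝ] Lp ℝ 2 μs, ∀ g k, ip.inner (N g) k = ip.inner g (N' k)
  then h.choose else 0

theorem exists_adjoint (ip : InnerProductSpace.Core ℝ (Lp ℝ 2 μs)) {c C : ℝ} (hc : 0 < c)
    (hlow : ∀ g, c * ‖g‖ ≤ normSharp ip g) (hup : ∀ g, normSharp ip g ≤ C * ‖g‖)
    (N : Lp ℝ 2 μs →L[ℝ] Lp ℝ 2 μs) :
    ∃ N' : Lp ℝ 2 μs →ₗ[ℝ] Lp ℝ 2 μs, ∀ g k, ip.inner (N g) k = ip.inner g (N' k) := by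
  have hsymm : ∀ x y, ip.inner y x = ip.inner x y := fun x y => by
    simpa using ip.conj_inner_symm x y
  have hsmul : ∀ (r : ℝ) x y, ip.inner (r • x) y = r * ip.inner x y := fun r x y => by
    simpa using ip.smul_left x y r
  have hnn : ∀ x, 0 ≤ ip.inner x x := fun x => by simpa using ip.re_inner_nonneg x
  let B₀ : Lp ℝ 2 μs →ₗ[ℝ] Lp ℝ 2 μs →ₗ[ℝ] ℝ := LinearMap.mk₂ ℝ ip.inner ip.add_left
    (fun r x y => hsmul r x y)
    (fun x y z => by rw [← hsymm x, ip.add_left, hsymm x, hsymm x])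
    (fun r x y => by rw [← hsymm x, hsmul, hsymm x]; rfl)
  have hcs : ∀ x y, |ip.inner x y| ≤ normSharp ip x * normSharp ip y := fun x y =>
    @InnerProductSpace.Core.norm_inner_le_norm ℝ (Lp ℝ 2 μs) _ _ _ ip.toCore x y
  have hbd : ∀ x y, ‖B₀ x y‖ ≤ C ^ 2 * ‖x‖ * ‖y‖ := fun x y => by
    refine (hcs x y).trans ?_
    calc normSharp ip x * normSharp ip y ≤ (C * ‖x‖) * (C * ‖y‖) :=
          mul_le_mul (hup x) (hup y) (Real.sqrt_nonneg _) ((Real.sqrt_nonneg _).trans (hup x))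
      _ = C ^ 2 * ‖x‖ * ‖y‖ := by ring
  let B := B₀.mkContinuous₂ (C ^ 2) hbd
  have hB : ∀ x y, B x y = ip.inner x y := fun x y => rfl
  have hco : IsCoercive B := ⟨c ^ 2, by positivity, fun u => by
    rw [hB]
    have h1 := hlow u
    have h2 : normSharp ip u * normSharp ip u = ip.inner u u := Real.mul_self_sqrt (hnn u)
    have h3 : 0 ≤ c * ‖u‖ := by positivity
    nlinarith⟩
  let L := hco.continuousLinearEquivOfBilin
  have hL : ∀ v w, inner ℝ (L v) w = ip.inner v w := fun v w =>
    hco.continuousLinearEquivOfBilin_apply v w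
  refine ⟨(L.symm : Lp ℝ 2 μs →L[ℝ] Lp ℝ 2 μs).toLinearMap ∘ₗ
    (ContinuousLinearMap.adjoint N).toLinearMap ∘ₗ
    (L : Lp ℝ 2 μs →L[ℝ] Lp ℝ 2 μs).toLinearMap, fun g k => ?_⟩
  have : ip.inner (L.symm (ContinuousLinearMap.adjoint N (L k))) g = ip.inner k (N g) := by
    rw [← hL, ← hL, L.apply_symm_apply, ContinuousLinearMap.adjoint_inner_left]
  rw [hsymm k, ← this, hsymm]
  rfl

/-- If `‖·‖_#` is equivalent to the `L²(μs)` norm, then `adjoint` is the adjoint. -/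
theorem adjoint_spec (ip : InnerProductSpace.Core ℝ (Lp ℝ 2 μs)) {c C : ℝ} (hc : 0 < c)
    (hlow : ∀ g, c * ‖g‖ ≤ normSharp ip g) (hup : ∀ g, normSharp ip g ≤ C * ‖g‖)
    (N : Lp ℝ 2 μs →L[ℝ] Lp ℝ 2 μs) (g k : Lp ℝ 2 μs) :
    ip.inner (N g) k = ip.inner g (adjoint ip N k) := by
  have h := exists_adjoint ip hc hlow hup N
  rw [adjoint, dif_pos h]
  exact h.choose_spec g k

/-- The multiplication operator `M_φ g = φ g` on `L²(μs)`, for `φ ∈ L^∞(μs)`. -/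
def mulOp (φ : E → ℝ) (hφ : MemLp φ ∞ μs) : Lp ℝ 2 μs →L[ℝ] Lp ℝ 2 μs :=
  (ContinuousLinearMap.mul ℝ ℝ).holderL μs ∞ 2 2 (hφ.toLp φ)

theorem coeFn_mulOp (φ : E → ℝ) (hφ : MemLp φ ∞ μs) (g : Lp ℝ 2 μs) :
    mulOp φ hφ g =ᵐ[μs] fun x => φ x * g x := by
  have h := (ContinuousLinearMap.mul ℝ ℝ).coeFn_holder (r := 2) (hφ.toLp φ) g
  filter_upwards [h, hφ.coeFn_toLp] with x h1 h2
  rw [← h2]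
  exact h1

/-- The variance-type constant `2 α ‖½ (N + N†) 1‖_#²`. -/
def vConst [IsFiniteMeasure μs] (ip : InnerProductSpace.Core ℝ (Lp ℝ 2 μs)) (α : ℝ)
    (N : Lp ℝ 2 μs →L[ℝ] Lp ℝ 2 μs) : ℝ :=
  2 * α * normSharp ip ((1 / 2 : ℝ) •
    (N (Lp.const 2 μs (1 : ℝ)) + adjoint ip N (Lp.const 2 μs (1 : ℝ)))) ^ 2

/-- The constant `α max {0, sup_{‖g‖_# = 1} ⟨N g, g⟩_#}`. -/
def bConst (ip : InnerProductSpace.Core ℝ (Lp ℝ 2 μs)) (α : ℝ)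
    (N : Lp ℝ 2 μs →L[ℝ] Lp ℝ 2 μs) : ℝ :=
  α * max 0 (sSup {r | ∃ g, normSharp ip g = 1 ∧ r = ip.inner (N g) g})

/-- `± f̂ = s (f - μs[f])`, with the sign `s`. -/
def centered (μs : Measure E) (f : E → ℝ) (s : ℝ) (x : E) : ℝ := s * (f x - ∫ y, f y ∂μs)

theorem memLp_centered {f : E → ℝ} (hf : Measurable f) (hb : ∃ K, ∀ x, |f x| ≤ K) (s : ℝ) :
    MemLp (centered μs f s) ∞ μs := by
  obtain ⟨K, hK⟩ := hb
  have hm : Measurable (centered μs f s) := (hf.sub_const _).const_mul s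
  refine memLp_top_of_bound hm.aestronglyMeasurable (|s| * (K + |∫ y, f y ∂μs|))
    (Eventually.of_forall fun x => ?_)
  rw [Real.norm_eq_abs, centered, abs_mul]
  refine mul_le_mul_of_nonneg_left ?_ (abs_nonneg s)
  exact (abs_sub _ _).trans (add_le_add_left (hK x) _)

/-- The norm `‖dμ/dμs‖` in `L²(μs)`, in `[0,∞]`. -/
def densityNorm (μ μs : Measure E) : ℝ≥0∞ :=
  eLpNorm (fun x => (μ.rnDeriv μs x).toReal) 2 μs

/-- Hypotheses on a modified inner product `⟨·,·⟩_#` on `L²(μs)` relative to the generator of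
the Markov process `M`: norm equivalence, `⟨g,1⟩_# = ⟨g,1⟩`, and the Poincaré inequality
`‖g‖_#² ≤ α ⟨-A g, g⟩_#` for all `g ∈ D(A)` with `μs[g] = 0`. -/
structure ModifiedPoincare {Ω : Type*} [MeasurableSpace Ω] [TopologicalSpace E]
    [IsFiniteMeasure μs] (M : MarkovProcess Ω E) (ip : InnerProductSpace.Core ℝ (Lp ℝ 2 μs))
    (c C α : ℝ) : Prop where
  c_pos : 0 < c
  c_le_C : c ≤ C
  lower : ∀ g, c * ‖g‖ ≤ normSharp ip g
  upper : ∀ g, normSharp ip g ≤ C * ‖g‖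
  inner_one : ∀ g, ip.inner g (Lp.const 2 μs (1 : ℝ)) = inner ℝ g (Lp.const 2 μs (1 : ℝ))
  alpha_pos : 0 < α
  poincare : ∀ g h : Lp ℝ 2 μs, M.Generates μs g h → ∫ x, g x ∂μs = 0 →
    normSharp ip g ^ 2 ≤ α * ip.inner (-h) g

end InnerProduct

end

end HypoUQ

/-! Put `φ = ±f̂` and split the difference of expectations at `μ*[f]`.

Entropy part. The Donsker–Varadhan inequality on path space, applied to `∫₀ᵀ l φ(x_r) dr`, bounds `l
T` times `±(Ẽ[F̃_T] - μ*[f])` by the relative entropy plus the logarithm of `E^μ[exp ∫₀ᵀ l φ(X_r)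
dr]`. This moment is `∫ u_T dμ`, where `u_t = E^x[exp ∫₀ᵗ l φ(X_r) dr]` solves `u' = (A + l M_φ) u`,
`u_0 = 1`. Write `u = a·1 + u₀` with `μ*[u₀] = 0`. In `⟨(A + l M_φ) u, u⟩_#` the Poincaré inequality
and `b` bound the part quadratic in `u₀`, the cross term is `2 l a ⟨½(M + M†)1, u₀⟩_#`, and the `a²`
term vanishes because `μ*[φ] = 0`. Completing the square (`form_perturbation_le`) gives the growth
rate `κ = l² v / (2(1 - l b))`, so `‖u_T‖_# ≤ e^{κT}` by Grönwall. Cauchy–Schwarz against `dμ/dμ*`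
then costs `c⁻¹ ‖dμ/dμ*‖`. Division by `l T` leaves `l v / (2(1 - l b)) + η / l`, which is minimised
over `l` in `le_sqrt_add_mul_of_forall`.

Bias part. The mean additive functional `u_t = E^x[∫₀ᵗ φ(X_r) dr]` solves `u' = A u + φ`, `u_0 = 0`,
and has mean zero under `μ*`. Grönwall with rate `-1/α` gives `‖u_T‖_# ≤ α (1 - e^{-T/α}) ‖φ‖_#`.

No perturbation theory for `A + l M_φ` is needed. Both curves consist of bounded functions, and for
them right differentiability in `L²(μ*)` and membership in `D(A)` follow from the Markov property on
path space together with small-time limits under the stationary law.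

For the asymptotic bound, take `μ = μ*`, let `T → ∞` with `l` fixed, and minimise over `l`
afterwards. -/

namespace HypoUQ

/-! ### Grönwall, optimisation over `l`, entropy duality, and the square to be completed. -/

theorem sqrt_form_le_gronwallBound {H : Type*} [NormedAddCommGroup H] [NormedSpace ℝ H]
    (B : H →L[ℝ] H →L[ℝ] ℝ) (hsymm : ∀ x y, B x y = B y x) (hnn : ∀ x, 0 ≤ B x x)
    {w w' : ℝ → H} {T κ β : ℝ} (hT : 0 ≤ T) (hβ : 0 ≤ β) (hw : ContinuousOn w (Icc 0 T))
    (hw' : ∀ t ∈ Ico 0 T, HasDerivWithinAt w (w' t) (Ici t) t)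
    (hbound : ∀ t ∈ Ico 0 T, B (w' t) (w t) ≤ κ * B (w t) (w t) + β * √(B (w t) (w t))) :
    √(B (w T) (w T)) ≤ gronwallBound (√(B (w 0) (w 0))) κ β T := by
  -- The square root is not differentiable where the form vanishes, so Grönwall is run for `√(B w w
  -- + δ²)`. This costs `δ` in the initial value and `|κ| δ` in the forcing (`κ` may have either
  -- sign); both disappear as `δ → 0`.
  have key : ∀ δ : ℝ, 0 < δ → √(B (w T) (w T)) ≤
      gronwallBound (√(B (w 0) (w 0)) + δ) κ (β + |κ| * δ) T := by
    intro δ hδ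
    have hpos : ∀ t, 0 < B (w t) (w t) + δ ^ 2 := fun t => by have := hnn (w t); positivity
    have hder : ∀ t ∈ Ico 0 T, HasDerivWithinAt (fun t => √(B (w t) (w t) + δ ^ 2))
        (B (w' t) (w t) / √(B (w t) (w t) + δ ^ 2)) (Ici t) t := by
      intro t ht
      have h1 : HasDerivWithinAt (fun t => B (w t) (w t)) (B (w t) (w' t) + B (w' t) (w t))
          (Ici t) t := B.hasDerivWithinAt_of_bilinear (hw' t ht) (hw' t ht)
      have h2 := (h1.add_const (δ ^ 2)).sqrt (hpos t).ne'
      convert h2 using 1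
      rw [hsymm (w t) (w' t)]
      have := Real.sqrt_pos.2 (hpos t)
      field_simp
      ring
    have hcont : ContinuousOn (fun t => √(B (w t) (w t) + δ ^ 2)) (Icc 0 T) := by
      have : ContinuousOn (fun t => B (w t) (w t)) (Icc 0 T) :=
        (B.continuous.comp_continuousOn hw).clm_apply hw
      exact (this.add continuousOn_const).sqrt
    have h0 : √(B (w 0) (w 0) + δ ^ 2) ≤ √(B (w 0) (w 0)) + δ := by
      have h1 := Real.sqrt_nonneg (B (w 0) (w 0))
      refine Real.sqrt_le_iff.2 ⟨by positivity, ?_⟩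
      nlinarith [Real.sq_sqrt (hnn (w 0)), mul_nonneg h1 hδ.le]
    have hb : ∀ t ∈ Ico 0 T, B (w' t) (w t) / √(B (w t) (w t) + δ ^ 2) ≤
        κ * √(B (w t) (w t) + δ ^ 2) + (β + |κ| * δ) := by
      intro t ht
      set m := B (w t) (w t) with hm
      have hq : 0 < √(m + δ ^ 2) := Real.sqrt_pos.2 (hpos t)
      have hqs : √(m + δ ^ 2) * √(m + δ ^ 2) = m + δ ^ 2 := Real.mul_self_sqrt (hpos t).le
      have hmq : √m ≤ √(m + δ ^ 2) := Real.sqrt_le_sqrt (by nlinarith)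
      have hδq : δ ≤ √(m + δ ^ 2) := Real.le_sqrt_of_sq_le (by linarith [hnn (w t)])
      rw [div_le_iff₀ hq]
      have e1 := hbound t ht
      rw [← hm] at e1
      have e2 : β * √m ≤ β * √(m + δ ^ 2) := mul_le_mul_of_nonneg_left hmq hβ
      have e3 : -(κ * δ ^ 2) ≤ |κ| * δ * √(m + δ ^ 2) := by
        have : -κ * δ ^ 2 ≤ |κ| * δ ^ 2 :=
          mul_le_mul_of_nonneg_right (neg_le_abs κ) (by positivity)
        have h4 : |κ| * δ * δ ≤ |κ| * δ * √(m + δ ^ 2) :=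
          mul_le_mul_of_nonneg_left hδq (by positivity)
        nlinarith
      calc B (w' t) (w t) ≤ κ * (m + δ ^ 2) + β * √(m + δ ^ 2) + |κ| * δ * √(m + δ ^ 2) := by
            linarith
        _ = _ := by linear_combination (-κ) * hqs
    have := le_gronwallBound_of_liminf_deriv_right_le hcont
      (fun t ht r hr => (hder t ht).liminf_right_slope_le hr) h0 hb T ⟨hT, le_rfl⟩
    rw [sub_zero] at this
    exact (Real.sqrt_le_sqrt (by nlinarith)).trans this
  have hlim : Tendsto (fun δ : ℝ => gronwallBound (√(B (w 0) (w 0)) + δ) κ (β + |κ| * δ) T)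
      (𝓝[>] 0) (𝓝 (gronwallBound (√(B (w 0) (w 0))) κ β T)) := by
    have : Continuous
        (fun δ : ℝ => gronwallBound (√(B (w 0) (w 0)) + δ) κ (β + |κ| * δ) T) := by
      unfold gronwallBound
      split_ifs <;> fun_prop
    have h2 := this.tendsto 0
    simp only [add_zero, mul_zero] at h2
    exact h2.mono_left nhdsWithin_le_nhds
  exact ge_of_tendsto hlim (eventually_nhdsWithin_of_forall fun δ hδ => key δ hδ)

/-- The minimiser is `l = 1/(b + r)` with `r = √(v/(2η))`: the two terms become `η r` and `η (b +
r)`, and `2 η r = √(2 v η)`. Enlarging `v` and `η` by `ε` keeps `r` positive and finite when one of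
them vanishes. -/
theorem le_sqrt_add_mul_of_forall {x v b η : ℝ} (hv : 0 ≤ v) (hb : 0 ≤ b) (hη : 0 ≤ η)
    (h : ∀ l : ℝ, 0 < l → l * b < 1 → x ≤ l * v / (2 * (1 - l * b)) + η / l) :
    x ≤ √(2 * v * η) + b * η := by
  have key : ∀ ε : ℝ, 0 < ε → x ≤ √(2 * (v + ε) * (η + ε)) + b * (η + ε) := by
    intro ε hε
    set v' := v + ε with hv'
    set e' := η + ε with he'
    have hv0 : 0 < v' := by positivity
    have he0 : 0 < e' := by positivity
    set r := √(v' / (2 * e')) with hr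
    have hr0 : 0 < r := by positivity
    have hr2 : r ^ 2 = v' / (2 * e') := Real.sq_sqrt (by positivity)
    have hs : √(2 * v' * e') = 2 * e' * r := by
      rw [show 2 * v' * e' = (2 * e' * r) ^ 2 by rw [mul_pow, hr2]; field_simp,
        Real.sqrt_sq (by positivity)]
    have hbr : 0 < b + r := by positivity
    have hl : 1 - 1 / (b + r) * b = r / (b + r) := by field_simp; ring
    have hlr : 0 < 1 - 1 / (b + r) * b := by rw [hl]; positivity
    have := h (1 / (b + r)) (by positivity) (by linarith)
    have h2 : 1 / (b + r) * v / (2 * (1 - 1 / (b + r) * b)) + η / (1 / (b + r)) ≤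
        1 / (b + r) * v' / (2 * (1 - 1 / (b + r) * b)) + e' / (1 / (b + r)) := by
      gcongr <;> linarith
    have h3 : 1 / (b + r) * v' / (2 * (1 - 1 / (b + r) * b)) = e' * r := by
      rw [hl]
      have : v' = 2 * e' * r ^ 2 := by rw [hr2]; field_simp
      rw [this]; field_simp
    rw [h3] at h2
    rw [hs]
    have h4 : e' / (1 / (b + r)) = e' * (b + r) := by field_simp
    rw [h4] at h2
    linarith
  have hlim : Tendsto (fun ε : ℝ => √(2 * (v + ε) * (η + ε)) + b * (η + ε)) (𝓝[>] 0)
      (𝓝 (√(2 * v * η) + b * η)) := by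
    have : Continuous (fun ε : ℝ => √(2 * (v + ε) * (η + ε)) + b * (η + ε)) := by fun_prop
    have h2 := this.tendsto 0
    simp only [add_zero] at h2
    exact h2.mono_left nhdsWithin_le_nhds
  exact ge_of_tendsto hlim (eventually_nhdsWithin_of_forall fun δ hδ => key δ hδ)

/-- The Donsker–Varadhan inequality for bounded functions. -/
theorem integral_le_klDiv_add_log {S : Type*} [MeasurableSpace S] (Q P : Measure S)
    [IsProbabilityMeasure Q] [IsProbabilityMeasure P]
    (hQP : InformationTheory.klDiv Q P ≠ ∞) {F : S → ℝ} (hF : Measurable F) {K : ℝ}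
    (hK : ∀ x, |F x| ≤ K) :
    ∫ x, F x ∂Q ≤ (InformationTheory.klDiv Q P).toReal + Real.log (∫ x, Real.exp (F x) ∂P) := by
  obtain ⟨hac, hint⟩ := InformationTheory.klDiv_ne_top_iff.1 hQP
  have hFQ : Integrable F Q := .of_bound hF.aestronglyMeasurable K (.of_forall hK)
  have hexp : Integrable (fun x => Real.exp (F x)) P :=
    .of_bound hF.exp.aestronglyMeasurable (Real.exp K) (.of_forall fun x => by
      rw [Real.norm_eq_abs, Real.abs_exp]
      exact Real.exp_le_exp.2 ((le_abs_self _).trans (hK x)))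
  have hP' : IsProbabilityMeasure (P.tilted F) := isProbabilityMeasure_tilted hexp
  have hac' : Q ≪ P.tilted F := hac.trans (absolutelyContinuous_tilted hexp)
  -- With `P_F ∝ e^F P`, the entropy of `Q` relative to `P_F` equals `KL(Q‖P) - ∫ F dQ + log ∫ e^F
  -- dP`; the claim is its nonnegativity.
  have h1 := integral_llr_tilted_right hac hFQ hexp hint
  have h2 := InformationTheory.toReal_klDiv_of_measure_eq hac' (by simp)
  have h3 := InformationTheory.toReal_klDiv_of_measure_eq hac (by simp)
  have h4 : 0 ≤ (InformationTheory.klDiv Q (P.tilted F)).toReal := ENNReal.toReal_nonneg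
  rw [h3]
  linarith

/-- In the application `e` is the constant function `1`, `h` is `A u` and `e'` is `N† e`. With `k =
½(N e + e')` the left side is at most `-(1 - l b)/α · ‖u₀‖² + 2 l a ⟨k, u₀⟩`, whose maximum over
`u₀` is `l² a² α ‖k‖² / (1 - l b)`. -/
theorem form_perturbation_le {H : Type*} [AddCommGroup H] [Module ℝ H]
    (B : H →ₗ[ℝ] H →ₗ[ℝ] ℝ) (hsymm : ∀ x y, B x y = B y x) (hnn : ∀ x, 0 ≤ B x x)
    (N : H →ₗ[ℝ] H) {e e' u₀ h : H} {a α b l : ℝ} (he : B e e = 1) (hu₀ : B u₀ e = 0)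
    (hh : B h e = 0) (hα : 0 < α) (hpoinc : B u₀ u₀ ≤ α * B (-h) u₀)
    (hNe : B (N e) e = 0) (hadj : ∀ g, B (N g) e = B g e')
    (hNb : ∀ g, α * B (N g) g ≤ b * B g g) (hl : 0 < l) (hlb : l * b < 1) :
    B (h + l • N (a • e + u₀)) (a • e + u₀) ≤
      l ^ 2 * (2 * α * B ((1 / 2 : ℝ) • (N e + e')) ((1 / 2 : ℝ) • (N e + e'))) /
        (2 * (1 - l * b)) * B (a • e + u₀) (a • e + u₀) := by
  set k := (1 / 2 : ℝ) • (N e + e') with hk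
  have hd : 0 < 1 - l * b := by linarith
  have hku : B (N e) u₀ + B (N u₀) e = 2 * B k u₀ := by
    rw [hadj, hk, hsymm u₀ e']
    simp
    ring
  have hLHS : B (h + l • N (a • e + u₀)) (a • e + u₀) =
      B h u₀ + l * (2 * a * B k u₀ + B (N u₀) u₀) := by
    have : 2 * a * B k u₀ = a * (B (N e) u₀ + B (N u₀) e) := by rw [hku]; ring
    rw [this]
    simp [hh, hNe]
    ring
  have hRHS : B (a • e + u₀) (a • e + u₀) = a ^ 2 + B u₀ u₀ := by
    simp [hu₀, he, hsymm e u₀]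
    ring
  -- The subtracted vector is the maximiser of that quadratic expression in `u₀`.
  have hy := hnn (u₀ - (l * a * α / (1 - l * b)) • k)
  have hye : B (u₀ - (l * a * α / (1 - l * b)) • k) (u₀ - (l * a * α / (1 - l * b)) • k) =
      B u₀ u₀ - 2 * (l * a * α / (1 - l * b)) * B k u₀ +
        (l * a * α / (1 - l * b)) ^ 2 * B k k := by
    simp [hsymm u₀ k]
    ring
  rw [hye] at hy
  have h1 : B h u₀ ≤ - B u₀ u₀ / α := by
    rw [le_div_iff₀ hα]
    simp at hpoinc
    linarith
  have h2 : B (N u₀) u₀ ≤ b * B u₀ u₀ / α := by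
    rw [le_div_iff₀ hα]
    linarith [hNb u₀]
  -- The square yields a bound by a multiple of `a²` alone; the target has `a² + ‖u₀‖²`, and this is
  -- the nonnegative surplus.
  have h3 : 0 ≤ l ^ 2 * (2 * α * B k k) / (2 * (1 - l * b)) * B u₀ u₀ := by
    have := hnn k
    have := hnn u₀
    positivity
  have h5 := mul_nonneg (div_nonneg hd.le hα.le) hy
  have h6 : (1 - l * b) / α * (B u₀ u₀ - 2 * (l * a * α / (1 - l * b)) * B k u₀ +
        (l * a * α / (1 - l * b)) ^ 2 * B k k) = B u₀ u₀ / α - l * (b * B u₀ u₀ / α)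
        - l * (2 * a * B k u₀) + l ^ 2 * (2 * α * B k k) / (2 * (1 - l * b)) * a ^ 2 := by
    field_simp
  rw [hLHS, hRHS]
  rw [h6] at h5
  have h7 := mul_le_mul_of_nonneg_left h2 hl.le
  rw [neg_div] at h1
  linarith

/-! ### Joint measurability and path functionals -/

/-- Rounding `t` up to the grid of mesh `1/(n+1)`. The approximant depends on `t` only through a
natural number, which reduces joint measurability of a right-continuous process to countably many
times. -/
theorem exists_tendsto_floor_nhdsGE : ∃ b : ℕ → ℕ → ℝ≥0, ∀ t : ℝ≥0,
    Tendsto (fun n : ℕ => b n ⌊((n : ℝ≥0) + 1) * t⌋₊) atTop (𝓝[≥] t) := by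
  refine ⟨fun n k => ((k : ℝ≥0) + 1) / ((n : ℝ≥0) + 1), fun t => ?_⟩
  have hpos : ∀ n : ℕ, (0 : ℝ≥0) < (n : ℝ≥0) + 1 := fun n => by positivity
  have h1 : ∀ n : ℕ, t ≤ ((⌊((n : ℝ≥0) + 1) * t⌋₊ : ℝ≥0) + 1) / ((n : ℝ≥0) + 1) := fun n => by
    rw [le_div_iff₀ (hpos n), mul_comm]
    exact (Nat.lt_floor_add_one _).le
  have h2 : ∀ n : ℕ, ((⌊((n : ℝ≥0) + 1) * t⌋₊ : ℝ≥0) + 1) / ((n : ℝ≥0) + 1) ≤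
      t + 1 / ((n : ℝ≥0) + 1) := fun n => by
    rw [div_le_iff₀ (hpos n), add_mul _ _ ((n : ℝ≥0) + 1), one_div,
      inv_mul_cancel₀ (hpos n).ne', mul_comm t]
    gcongr
    exact Nat.floor_le zero_le
  refine tendsto_nhdsWithin_iff.2 ⟨?_, .of_forall h1⟩
  refine tendsto_of_tendsto_of_tendsto_of_le_of_le tendsto_const_nhds ?_ h1 h2
  simpa using (tendsto_const_nhds (x := t)).add
    (tendsto_one_div_add_atTop_nhds_zero_nat (𝕜 := ℝ≥0))

theorem measurable_uncurry_of_rightContinuous {Ω E : Type*} [MeasurableSpace Ω]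
    [TopologicalSpace E] [TopologicalSpace.PseudoMetrizableSpace E] [MeasurableSpace E]
    [BorelSpace E] {X : ℝ≥0 → Ω → E} (hm : ∀ t, Measurable (X t))
    (hr : ∀ ω t, ContinuousWithinAt (fun t => X t ω) (Ici t) t) :
    Measurable (fun p : ℝ≥0 × Ω => X p.1 p.2) := by
  obtain ⟨b, hb⟩ := exists_tendsto_floor_nhdsGE
  refine measurable_of_tendsto_metrizable
    (f := fun (n : ℕ) (p : ℝ≥0 × Ω) => X (b n ⌊((n : ℝ≥0) + 1) * p.1⌋₊) p.2)
    (fun n => ?_) (tendsto_pi_nhds.2 fun p => (hr p.2 p.1).tendsto.comp (hb p.1))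
  have h1 : Measurable (fun q : ℕ × Ω => X (b n q.1) q.2) :=
    measurable_from_prod_countable_right fun k => hm (b n k)
  have h2 : Measurable (fun p : ℝ≥0 × Ω => (⌊((n : ℝ≥0) + 1) * p.1⌋₊, p.2)) :=
    (Nat.measurable_floor.comp (measurable_fst.const_mul _)).prodMk measurable_snd
  exact h1.comp h2

/-- The additive functional `∫₀ᵗ V(X_r) dr`. -/
noncomputable def occupation {Ω E : Type*} (V : E → ℝ) (X : ℝ≥0 → Ω → E) (t : ℝ≥0) (ω : Ω) : ℝ :=
  ∫ r in (0 : ℝ)..t, V (X r.toNNReal ω)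

/-- The additive functional `∫₀ᵀ V(x_r) dr` of a path `x` on `[0,T]`. -/
noncomputable def pathOccupation {E : Type*} [TopologicalSpace E] {T : ℝ≥0} (V : E → ℝ)
    (x : PathSpace E T) : ℝ :=
  occupation V (fun r (x : PathSpace E T) => x.1 (projIcc 0 T zero_le r)) T x

section Occupation

variable {Ω E : Type*}

theorem pathOccupation_pathMap [TopologicalSpace E] (V : E → ℝ) (X : ℝ≥0 → Ω → E)
    (hX : ∀ ω, IsCadlag (fun t => X t ω)) (T : ℝ≥0) (ω : Ω) :
    pathOccupation V (pathMap X hX T ω) = occupation V X T ω := by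
  refine intervalIntegral.integral_congr fun r hr => ?_
  rw [uIcc_of_le T.coe_nonneg] at hr
  have : r.toNNReal ∈ Icc 0 T := ⟨zero_le, Real.toNNReal_le_iff_le_coe.2 hr.2⟩
  simp only [pathMap, projIcc_of_mem _ this]

theorem measurable_occupation [MeasurableSpace Ω] [TopologicalSpace E]
    [TopologicalSpace.PseudoMetrizableSpace E] [MeasurableSpace E]
    [BorelSpace E] {X : ℝ≥0 → Ω → E} (hm : ∀ t, Measurable (X t))
    (hr : ∀ ω t, ContinuousWithinAt (fun t => X t ω) (Ici t) t) {V : E → ℝ} (hV : Measurable V)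
    (T : ℝ≥0) : Measurable (occupation V X T) := by
  have h1 : Measurable (fun p : Ω × ℝ => V (X p.2.toNNReal p.1)) :=
    hV.comp ((measurable_uncurry_of_rightContinuous hm hr).comp
      (measurable_snd.real_toNNReal.prodMk measurable_fst))
  have h2 : occupation V X T = fun ω => ∫ r in Ioc (0 : ℝ) T, V (X r.toNNReal ω) := by
    ext ω
    exact intervalIntegral.integral_of_le T.coe_nonneg
  rw [h2]
  exact (h1.stronglyMeasurable.integral_prod_right (ν := volume.restrict (Ioc (0 : ℝ) T))).measurable

theorem IsCadlag.continuousWithinAt_projIcc [TopologicalSpace E] {T : ℝ≥0} (x : PathSpace E T)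
    (t : ℝ≥0) : ContinuousWithinAt (fun r => x.1 (projIcc 0 T zero_le r)) (Ici t) t := by
  refine ((x.2 (projIcc 0 T zero_le t)).1).tendsto.comp (tendsto_nhdsWithin_iff.2
    ⟨continuous_projIcc.continuousAt.tendsto.mono_left nhdsWithin_le_nhds, ?_⟩)
  filter_upwards [self_mem_nhdsWithin] with u hu using monotone_projIcc _ (show t ≤ u from hu)

theorem measurable_pathSpace_eval [TopologicalSpace E] [MeasurableSpace E] {T : ℝ≥0}
    (t : Icc (0 : ℝ≥0) T) : Measurable (fun x : PathSpace E T => x.1 t) :=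
  (measurable_pi_apply t).comp measurable_subtype_coe

theorem measurable_pathOccupation [TopologicalSpace E]
    [TopologicalSpace.PseudoMetrizableSpace E] [MeasurableSpace E] [BorelSpace E]
    {V : E → ℝ} (hV : Measurable V) (T : ℝ≥0) :
    Measurable (pathOccupation V : PathSpace E T → ℝ) :=
  measurable_occupation (fun _ => measurable_pathSpace_eval _)
    IsCadlag.continuousWithinAt_projIcc hV T

theorem abs_occupation_le {V : E → ℝ} {K : ℝ} (hK : ∀ x, |V x| ≤ K) (X : ℝ≥0 → Ω → E) (t : ℝ≥0)
    (ω : Ω) : |occupation V X t ω| ≤ K * t := by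
  have := intervalIntegral.norm_integral_le_of_norm_le_const (a := 0) (b := (t : ℝ)) (C := K)
    (f := fun r => V (X r.toNNReal ω)) (fun r _ => hK _)
  simpa [occupation, abs_of_nonneg t.coe_nonneg] using this

theorem abs_pathOccupation_le [TopologicalSpace E] {V : E → ℝ} {K : ℝ} (hK : ∀ x, |V x| ≤ K)
    {T : ℝ≥0} (x : PathSpace E T) : |pathOccupation V x| ≤ K * T :=
  abs_occupation_le hK _ T x

end Occupation

/-! ### The Markov property for path functionals -/

attribute [instance] MarkovProcess.isMarkovKernel

theorem IsCadlag.shift {E : Type*} [TopologicalSpace E] {x : ℝ≥0 → E} (hx : IsCadlag x) (s : ℝ≥0) :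
    IsCadlag (fun t => x (s + t)) := by
  intro t
  obtain ⟨h1, l, h2⟩ := hx (s + t)
  have hc : Tendsto (fun u : ℝ≥0 => s + u) (𝓝 t) (𝓝 (s + t)) :=
    (continuous_const.add continuous_id).continuousAt
  refine ⟨?_, l, ?_⟩
  · refine h1.tendsto.comp (tendsto_nhdsWithin_iff.2 ⟨hc.mono_left nhdsWithin_le_nhds, ?_⟩)
    filter_upwards [self_mem_nhdsWithin] with u hu
    exact add_le_add_right (show t ≤ u from hu) s
  · refine h2.comp (tendsto_nhdsWithin_iff.2 ⟨hc.mono_left nhdsWithin_le_nhds, ?_⟩)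
    filter_upwards [self_mem_nhdsWithin] with u hu
    exact add_lt_add_right (show u < t from hu) s

section Markov

variable {Ω E : Type*} [MeasurableSpace Ω] [TopologicalSpace E] [MeasurableSpace E]

theorem MarkovProcess.measurable_X (M : MarkovProcess Ω E) (t : ℝ≥0) : Measurable (M.X t) :=
  (M.adapted t).mono (M.filtration.le t) le_rfl

theorem MarkovProcess.ae_X_zero (M : MarkovProcess Ω E) [MeasurableSingletonClass E] (x : E) :
    ∀ᵐ ω ∂(M.P x), M.X 0 ω = x := by
  have h : ∀ᵐ y ∂((M.P x).map (M.X 0)), y = x := by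
    rw [M.initial x]
    exact (ae_dirac_iff (measurableSet_singleton x)).2 rfl
  exact ae_of_ae_map (M.measurable_X 0).aemeasurable h

/-- The Markov property for nonnegative functions. -/
theorem MarkovProcess.lintegral_mul_comp_X_add (M : MarkovProcess Ω E) (x : E) (s t : ℝ≥0)
    {Z : Ω → ℝ≥0∞} (hZ : Measurable[M.filtration s] Z) {ψ : E → ℝ≥0∞} (hψ : Measurable ψ) :
    ∫⁻ ω, Z ω * ψ (M.X (s + t) ω) ∂(M.P x) =
      ∫⁻ ω, Z ω * ∫⁻ ω', ψ (M.X t ω') ∂(M.P (M.X s ω)) ∂(M.P x) := by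
  have hle := M.filtration.le s
  have hk : Measurable fun y => ∫⁻ ω', ψ (M.X t ω') ∂(M.P y) :=
    (hψ.comp (M.measurable_X t)).lintegral_kernel
  have hks : Measurable fun ω => ∫⁻ ω', ψ (M.X t ω') ∂(M.P (M.X s ω)) :=
    hk.comp (M.measurable_X s)
  have hst := hψ.comp (M.measurable_X (s + t))
  have hset : ∀ A, MeasurableSet[M.filtration s] A →
      ∫⁻ ω in A, ψ (M.X (s + t) ω) ∂(M.P x) =
        ∫⁻ ω in A, ∫⁻ ω', ψ (M.X t ω') ∂(M.P (M.X s ω)) ∂(M.P x) := by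
    intro A hA
    -- As an identity of measures on `E` the claim need only be tested on sets `B`, where it is the
    -- defining Markov property integrated over `A`; every `ψ` follows at once.
    have hmeas : ((M.P x).restrict A).map (M.X (s + t)) =
        (((M.P x).restrict A).map (M.X s)).bind (M.P.map (M.X t)) := by
      ext B hB
      rw [Measure.map_apply (M.measurable_X _) hB, Measure.bind_apply hB (Kernel.aemeasurable _),
        lintegral_map (Kernel.measurable_coe _ hB) (M.measurable_X s)]
      simp_rw [Kernel.map_apply' _ (M.measurable_X t) _ hB]
      have h1 := setIntegral_condExp hle (μ := M.P x) (s := A)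
        (f := (M.X (s + t) ⁻¹' B).indicator (fun _ => (1 : ℝ)))
        ((integrable_const 1).indicator (M.measurable_X _ hB)) hA
      rw [setIntegral_congr_ae (hle _ hA) ((M.markov x s t B hB).mono fun ω h _ => h),
        integral_indicator_const _ (M.measurable_X _ hB), smul_eq_mul, mul_one] at h1
      have h2 : ∫ ω in A, (M.P (M.X s ω)).real (M.X t ⁻¹' B) ∂(M.P x) =
          (∫⁻ ω in A, M.P (M.X s ω) (M.X t ⁻¹' B) ∂(M.P x)).toReal := by
        refine integral_toReal ?_ (.of_forall fun ω => measure_lt_top _ _)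
        exact ((Kernel.measurable_coe _ (M.measurable_X t hB)).comp
          (M.measurable_X s)).aemeasurable
      rw [h2] at h1
      refine ((ENNReal.toReal_eq_toReal_iff' (measure_ne_top _ _) ?_).1 h1.symm)
      refine ne_top_of_le_ne_top (b := ∫⁻ ω in A, 1 ∂(M.P x)) (by simp) ?_
      exact lintegral_mono fun ω => prob_le_one
    rw [← lintegral_map hψ (M.measurable_X _), hmeas,
      Measure.lintegral_bind (Kernel.aemeasurable _) hψ.aemeasurable,
      lintegral_map hψ.lintegral_kernel (M.measurable_X s)]
    simp_rw [Kernel.map_apply _ (M.measurable_X t), lintegral_map hψ (M.measurable_X t)]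
  -- The identity on all `A` in `𝓕_s` says that the two weighted measures coincide on `𝓕_s`, and the
  -- integral of the `𝓕_s`-measurable `Z` sees only these trims.
  have htrim : ((M.P x).withDensity fun ω => ψ (M.X (s + t) ω)).trim hle =
      ((M.P x).withDensity fun ω => ∫⁻ ω', ψ (M.X t ω') ∂(M.P (M.X s ω))).trim hle := by
    refine @Measure.ext _ (M.filtration s) _ _ fun A hA => ?_
    rw [trim_measurableSet_eq hle hA, trim_measurableSet_eq hle hA,
      withDensity_apply _ (hle _ hA), withDensity_apply _ (hle _ hA), hset A hA]
  have h3 : ∀ ζ : Ω → ℝ≥0∞, Measurable ζ →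
      ∫⁻ ω, Z ω * ζ ω ∂(M.P x) = ∫⁻ ω, Z ω ∂((M.P x).withDensity ζ).trim hle := by
    intro ζ hζ
    rw [lintegral_trim hle hZ, lintegral_withDensity_eq_lintegral_mul _ hζ (hZ.mono hle le_rfl)]
    simp_rw [Pi.mul_apply, mul_comm]
  rw [h3 (fun ω => ψ (M.X (s + t) ω)) hst, h3 _ hks]
  exact congrArg (fun m => ∫⁻ ω, Z ω ∂m) htrim

/-- Finite-dimensional conditional distributions of a Markov process after time `s + u` depend on
the past only through `X_{s+u}`, uniformly in the starting point and in `s`. -/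
theorem MarkovProcess.exists_lintegral_prod_eq (M : MarkovProcess Ω E) {ι : Type*} [LinearOrder ι]
    {τ : ι → ℝ≥0} (hτ : Monotone τ) {ψ : ι → E → ℝ≥0∞} (hψ : ∀ i, Measurable (ψ i))
    (J : Finset ι) : ∀ u : ℝ≥0, (∀ j ∈ J, u ≤ τ j) → ∃ χ : E → ℝ≥0∞, Measurable χ ∧
      ∀ (x : E) (s : ℝ≥0) (Z : Ω → ℝ≥0∞), Measurable[M.filtration (s + u)] Z →
        ∫⁻ ω, Z ω * ∏ j ∈ J, ψ j (M.X (s + τ j) ω) ∂(M.P x) =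
          ∫⁻ ω, Z ω * χ (M.X (s + u) ω) ∂(M.P x) := by
  induction J using Finset.induction_on_min with
  | empty => exact fun u _ => ⟨fun _ => 1, measurable_const, by simp⟩
  | insert m J hm ih =>
    intro u hu
    obtain ⟨χ', hχ', h'⟩ := ih (τ m) fun j hj => hτ (hm j hj).le
    have hum : u ≤ τ m := hu m (Finset.mem_insert_self m J)
    -- The earliest time `τ m` is peeled off: the later factors are already condensed into `χ'` at
    -- time `τ m`, and the Markov property carries `ψ m * χ'` back over the gap `τ m - u`.
    refine ⟨fun y => ∫⁻ ω, ψ m (M.X (τ m - u) ω) * χ' (M.X (τ m - u) ω) ∂(M.P y),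
      ((((hψ m).mul hχ').comp (M.measurable_X (τ m - u))).lintegral_kernel), ?_⟩
    intro x s Z hZ
    have hmJ : m ∉ J := fun h => lt_irrefl _ (hm m h)
    simp_rw [Finset.prod_insert hmJ, ← mul_assoc]
    have hmono := M.filtration.mono (add_le_add_right hum s)
    rw [h' x s (fun ω => Z ω * ψ m (M.X (s + τ m) ω))
      ((hZ.mono hmono le_rfl).mul ((hψ m).comp (M.adapted _)))]
    have hst : s + τ m = (s + u) + (τ m - u) := by rw [add_assoc, add_tsub_cancel_of_le hum]
    have := M.lintegral_mul_comp_X_add x (s + u) (τ m - u) hZ ((hψ m).mul hχ')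
    simp only [Pi.mul_apply] at this
    rw [← this, hst]
    simp_rw [mul_assoc]

/-- The σ-algebra of path space is pulled back from the product, where finite-dimensional rectangles
form a generating π-system. -/
theorem pathSpace_measure_ext {T : ℝ≥0} {μ ν : Measure (PathSpace E T)} [IsFiniteMeasure μ]
    (h : ∀ (J : Finset (Icc (0 : ℝ≥0) T)) (B : Icc (0 : ℝ≥0) T → Set E),
      (∀ i, MeasurableSet (B i)) → μ {x | ∀ i ∈ J, x.1 i ∈ B i} = ν {x | ∀ i ∈ J, x.1 i ∈ B i}) :
    μ = ν := by
  let C : Set (Set (Icc (0 : ℝ≥0) T → E)) := squareCylinders fun _ => {s | MeasurableSet s}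
  have hgen : MeasurableSpace.generateFrom C = MeasurableSpace.pi := generateFrom_squareCylinders
  have hpi : IsPiSystem C := isPiSystem_squareCylinders
    (fun _ => MeasurableSpace.isPiSystem_measurableSet) fun _ => MeasurableSet.univ
  refine ext_of_generate_finite {s | ∃ t ∈ C, (Subtype.val : PathSpace E T → _) ⁻¹' t = s} ?_
    (hpi.comap _) ?_ ?_
  · change MeasurableSpace.comap Subtype.val MeasurableSpace.pi = _
    rw [← hgen, MeasurableSpace.comap_generateFrom]
    rfl
  · rintro _ ⟨_, ⟨J, B, hB, rfl⟩, rfl⟩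
    exact h J B fun i => hB i trivial
  · simpa using h ∅ (fun _ => univ) fun _ => MeasurableSet.univ

/-- The Markov property for the law of the path after time `s`. -/
theorem MarkovProcess.map_pathMap_shift (M : MarkovProcess Ω E) [MeasurableSingletonClass E]
    (x : E) (s t : ℝ≥0)
    {Z : Ω → ℝ≥0∞} (hZ : Measurable[M.filtration s] Z) (hfin : ∫⁻ ω, Z ω ∂(M.P x) ≠ ∞) :
    ((M.P x).withDensity Z).map
        (pathMap (fun r => M.X (s + r)) (fun ω => (M.cadlag ω).shift s) t) =
      ((M.P x).withDensity Z).bind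
        ((M.P.map (pathMap M.X M.cadlag t)).comap (M.X s) (M.measurable_X s)) := by
  have hm1 := measurable_pathMap (fun r => M.X (s + r)) (fun ω => (M.cadlag ω).shift s)
    (fun r => M.measurable_X _) t
  have hm2 := measurable_pathMap M.X M.cadlag M.measurable_X t
  have hZ' : Measurable Z := hZ.mono (M.filtration.le s) le_rfl
  have : IsFiniteMeasure ((M.P x).withDensity Z) := isFiniteMeasure_withDensity hfin
  refine pathSpace_measure_ext fun J B hB => ?_
  have hset : MeasurableSet {y : PathSpace E t | ∀ i ∈ J, y.1 i ∈ B i} := by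
    have : {y : PathSpace E t | ∀ i ∈ J, y.1 i ∈ B i} =
      ⋂ i ∈ J, (fun y : PathSpace E t => y.1 i) ⁻¹' B i := by ext; simp
    rw [this]
    exact J.measurableSet_biInter fun i _ => measurable_pathSpace_eval i (hB i)
  have hind : ∀ (Y : ℝ≥0 → Ω → E) (hY : ∀ ω, IsCadlag fun t => Y t ω) (ω : Ω),
      (pathMap Y hY t ⁻¹' {y | ∀ i ∈ J, y.1 i ∈ B i}).indicator (1 : Ω → ℝ≥0∞) ω =
        ∏ i ∈ J, (B i).indicator 1 (Y i ω) := by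
    intro Y hY ω
    by_cases h : ∀ i ∈ J, Y i ω ∈ B i
    · rw [indicator_of_mem (show ω ∈ pathMap Y hY t ⁻¹' {y | ∀ i ∈ J, y.1 i ∈ B i} from h),
        Finset.prod_eq_one fun i hi => by rw [indicator_of_mem (h i hi)]; rfl]
      rfl
    · rw [indicator_of_notMem (show ω ∉ pathMap Y hY t ⁻¹' {y | ∀ i ∈ J, y.1 i ∈ B i} from h)]
      push Not at h
      obtain ⟨i, hi, hiB⟩ := h
      rw [Finset.prod_eq_zero hi (indicator_of_notMem hiB _)]
  -- One `χ` serves all starting points and all shifts. Shift `0` with `Z = 1` identifies `χ y` as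
  -- the `P^y`-probability of the cylinder, since `X_0 = y` almost surely; shift `s` then gives the
  -- claim.
  obtain ⟨χ, hχ, h⟩ := M.exists_lintegral_prod_eq (τ := fun i : Icc (0 : ℝ≥0) t => (i : ℝ≥0))
    (fun _ _ h => h) (ψ := fun i => (B i).indicator 1)
    (fun i => measurable_one.indicator (hB i)) J 0 fun _ _ => zero_le
  have hχP : ∀ y, M.P y (pathMap M.X M.cadlag t ⁻¹' {y | ∀ i ∈ J, y.1 i ∈ B i}) = χ y := by
    intro y
    rw [← lintegral_indicator_one (hm2 hset)]
    simp_rw [hind]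
    have h0 := h y 0 (fun _ => 1) (@measurable_const _ _ _ (M.filtration (0 + 0)) _)
    simp only [one_mul, zero_add] at h0
    rw [h0, lintegral_congr_ae ((M.ae_X_zero y).mono fun ω hω => by rw [hω])]
    simp
  rw [Measure.map_apply hm1 hset, Measure.bind_apply hset (Kernel.aemeasurable _)]
  simp_rw [Kernel.comap_apply, Kernel.map_apply' _ hm2 _ hset, hχP]
  have hχs : Measurable fun ω => χ (M.X s ω) := hχ.comp (M.measurable_X s)
  rw [lintegral_withDensity_eq_lintegral_mul _ hZ' hχs, ← lintegral_indicator_one (hm1 hset),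
    lintegral_withDensity_eq_lintegral_mul _ hZ' (measurable_one.indicator (hm1 hset))]
  simp only [Pi.mul_apply, hind]
  have h1 := h x s Z (by rwa [add_zero])
  rw [add_zero] at h1
  exact h1

theorem integral_bind_kernel {α β : Type*} [MeasurableSpace α] [MeasurableSpace β] (m : Measure α)
    [IsFiniteMeasure m] (κ : Kernel α β) [IsMarkovKernel κ] {F : β → ℝ} (hF : Measurable F) {K : ℝ}
    (hK : ∀ y, |F y| ≤ K) : ∫ y, F y ∂(m.bind κ) = ∫ x, ∫ y, F y ∂(κ x) ∂m := by
  rw [← Measure.snd_compProd, Measure.snd, integral_map measurable_snd.aemeasurable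
    hF.aestronglyMeasurable, Measure.integral_compProd]
  exact .of_bound (hF.comp measurable_snd).aestronglyMeasurable K (.of_forall fun z => hK z.2)

/-- The Markov property for bounded functionals of the path. -/
theorem MarkovProcess.integral_mul_pathMap_shift (M : MarkovProcess Ω E)
    [MeasurableSingletonClass E] (x : E) (s t : ℝ≥0) {Z : Ω → ℝ}
    (hZ : Measurable[M.filtration s] Z) (hZ0 : ∀ ω, 0 ≤ Z ω) {L : ℝ} (hZL : ∀ ω, Z ω ≤ L)
    {F : PathSpace E t → ℝ} (hF : Measurable F) {K : ℝ} (hK : ∀ y, |F y| ≤ K) :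
    ∫ ω, Z ω * F (pathMap (fun r => M.X (s + r)) (fun ω => (M.cadlag ω).shift s) t ω) ∂(M.P x) =
      ∫ ω, Z ω * ∫ ω', F (pathMap M.X M.cadlag t ω') ∂(M.P (M.X s ω)) ∂(M.P x) := by
  have hm1 := measurable_pathMap (fun r => M.X (s + r)) (fun ω => (M.cadlag ω).shift s)
    (fun r => M.measurable_X _) t
  have hm2 := measurable_pathMap M.X M.cadlag M.measurable_X t
  have hZ' : Measurable Z := hZ.mono (M.filtration.le s) le_rfl
  have hfin : ∫⁻ ω, ENNReal.ofReal (Z ω) ∂(M.P x) ≠ ∞ := by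
    refine ne_top_of_le_ne_top (b := ∫⁻ ω, ENNReal.ofReal L ∂(M.P x)) (by simp) ?_
    exact lintegral_mono fun ω => ENNReal.ofReal_le_ofReal (hZL ω)
  have : IsFiniteMeasure ((M.P x).withDensity fun ω => ENNReal.ofReal (Z ω)) :=
    isFiniteMeasure_withDensity hfin
  have hmk : IsMarkovKernel (M.P.map (pathMap M.X M.cadlag t)) := Kernel.IsMarkovKernel.map _ hm2
  have h := congrArg (fun m => ∫ y, F y ∂m)
    (M.map_pathMap_shift x s t (Measurable.ennreal_ofReal hZ) hfin)
  rw [integral_map hm1.aemeasurable hF.aestronglyMeasurable, integral_bind_kernel _ _ hF hK] at h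
  simp_rw [Kernel.comap_apply, Kernel.map_apply _ hm2,
    integral_map hm2.aemeasurable hF.aestronglyMeasurable] at h
  rw [integral_withDensity_eq_integral_toReal_smul hZ'.ennreal_ofReal (by simp),
    integral_withDensity_eq_integral_toReal_smul hZ'.ennreal_ofReal (by simp)] at h
  simpa only [smul_eq_mul, ENNReal.toReal_ofReal (hZ0 _)] using h

end Markov

/-! ### `L²` estimates -/

section LTwo

variable {α β : Type*} [MeasurableSpace α] [MeasurableSpace β]

theorem eLpNorm_two_sq (f : α → ℝ) (m : Measure α) :
    eLpNorm f 2 m ^ 2 = ∫⁻ x, ‖f x‖ₑ ^ 2 ∂m := by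
  have := eLpNorm_nnreal_pow_eq_lintegral (μ := m) (f := f) (p := 2) two_ne_zero
  simpa using this

theorem enorm_integral_sq_le (m : Measure α) [IsProbabilityMeasure m] {f : α → ℝ}
    (hf : Measurable f) : ‖∫ x, f x ∂m‖ₑ ^ 2 ≤ ∫⁻ x, ‖f x‖ₑ ^ 2 ∂m := by
  rw [← eLpNorm_two_sq]
  refine ENNReal.pow_le_pow_left ((enorm_integral_le_lintegral_enorm f).trans ?_)
  rw [← eLpNorm_one_eq_lintegral_enorm]
  exact eLpNorm_le_eLpNorm_of_exponent_le one_le_two hf.aestronglyMeasurable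

/-- Jensen's inequality under each `κ x`. This is how `L²` estimates under the path measure descend
to `L²` of the state space. -/
theorem eLpNorm_integral_kernel_le (m : Measure α) (κ : Kernel α β) [IsMarkovKernel κ]
    {f : β → ℝ} (hf : Measurable f) :
    eLpNorm (fun x => ∫ y, f y ∂(κ x)) 2 m ≤ eLpNorm f 2 (m.bind κ) := by
  rw [← ENNReal.pow_le_pow_left_iff two_ne_zero, eLpNorm_two_sq, eLpNorm_two_sq,
    Measure.lintegral_bind (Kernel.aemeasurable _) (hf.enorm.pow_const 2).aemeasurable]
  exact lintegral_mono fun x => enorm_integral_sq_le (κ x) hf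

/-- Minkowski's inequality for an average over a probability space. -/
theorem eLpNorm_integral_le_of_forall (m : Measure α) [SFinite m] (ν : Measure β)
    [IsProbabilityMeasure ν] {f : α → β → ℝ} (hf : Measurable (Function.uncurry f)) {ε : ℝ≥0∞}
    (hε : ∀ᵐ y ∂ν, eLpNorm (fun x => f x y) 2 m ≤ ε) :
    eLpNorm (fun x => ∫ y, f x y ∂ν) 2 m ≤ ε := by
  rw [← ENNReal.pow_le_pow_left_iff two_ne_zero, eLpNorm_two_sq]
  calc ∫⁻ x, ‖∫ y, f x y ∂ν‖ₑ ^ 2 ∂m ≤ ∫⁻ x, ∫⁻ y, ‖f x y‖ₑ ^ 2 ∂ν ∂m :=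
        lintegral_mono fun x => enorm_integral_sq_le ν (hf.comp measurable_prodMk_left)
    _ = ∫⁻ y, ∫⁻ x, ‖f x y‖ₑ ^ 2 ∂m ∂ν := lintegral_lintegral_swap
        (hf.enorm.pow_const 2).aemeasurable
    _ ≤ ∫⁻ _, ε ^ 2 ∂ν := by
        refine lintegral_mono_ae (hε.mono fun y hy => ?_)
        rw [← eLpNorm_two_sq]
        exact ENNReal.pow_le_pow_left hy
    _ = ε ^ 2 := by simp

theorem eLpNorm_le_ofReal_of_bound (m : Measure α) [IsProbabilityMeasure m] {f : α → ℝ} {C : ℝ}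
    (h : ∀ x, |f x| ≤ C) : eLpNorm f 2 m ≤ ENNReal.ofReal C := by
  have := eLpNorm_le_of_ae_bound (p := 2) (μ := m) (f := f) (C := C) (.of_forall h)
  simpa using this

theorem tendsto_eLpNorm_of_le {ι : Type*} {l : Filter ι} {m : Measure α} {f : ι → α → ℝ}
    {a : ι → ℝ≥0∞} (ha : Tendsto a l (𝓝 0)) (h : ∀ᶠ i in l, eLpNorm (f i) 2 m ≤ a i) :
    Tendsto (fun i => eLpNorm (f i) 2 m) l (𝓝 0) :=
  tendsto_of_tendsto_of_tendsto_of_le_of_le' tendsto_const_nhds ha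
    (.of_forall fun _ => zero_le) h

theorem tendsto_eLpNorm_add {ι : Type*} {l : Filter ι} {m : Measure α} {f g : ι → α → ℝ}
    (hfm : ∀ i, Measurable (f i)) (hgm : ∀ i, Measurable (g i))
    (hf : Tendsto (fun i => eLpNorm (f i) 2 m) l (𝓝 0))
    (hg : Tendsto (fun i => eLpNorm (g i) 2 m) l (𝓝 0)) :
    Tendsto (fun i => eLpNorm (fun x => f i x + g i x) 2 m) l (𝓝 0) := by
  refine tendsto_eLpNorm_of_le (by simpa using hf.add hg) (.of_forall fun i => ?_)
  exact eLpNorm_add_le (hfm i).aestronglyMeasurable (hgm i).aestronglyMeasurable one_le_two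

theorem tendsto_eLpNorm_of_abs_le_mul {ι : Type*} {l : Filter ι} {m : Measure α} {f g : ι → α → ℝ}
    {C : ℝ} (h : ∀ i x, |f i x| ≤ C * |g i x|)
    (hg : Tendsto (fun i => eLpNorm (g i) 2 m) l (𝓝 0)) :
    Tendsto (fun i => eLpNorm (f i) 2 m) l (𝓝 0) := by
  refine tendsto_eLpNorm_of_le (a := fun i => ENNReal.ofReal C * eLpNorm (g i) 2 m) ?_
    (.of_forall fun i => eLpNorm_le_mul_eLpNorm_of_ae_le_mul (.of_forall (h i)) 2)
  simpa using ENNReal.Tendsto.const_mul hg (.inr ENNReal.ofReal_ne_top)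

end LTwo

/-! ### Stationary càdlàg Markov processes: small-time limits -/

section SmallTime

variable {Ω E : Type*} [MeasurableSpace Ω] [TopologicalSpace E] [MeasurableSpace E]
  (M : MarkovProcess Ω E) {μs : Measure E}

instance MarkovProcess.isProbabilityMeasure_law [IsProbabilityMeasure μs] :
    IsProbabilityMeasure (M.law μs) := by
  unfold MarkovProcess.law
  infer_instance

variable {M}

theorem MarkovProcess.IsInvariant.eLpNorm_comp_X (hinv : M.IsInvariant μs) (t : ℝ≥0) {g : E → ℝ}
    (hg : Measurable g) : eLpNorm (fun ω => g (M.X t ω)) 2 (M.law μs) = eLpNorm g 2 μs := by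
  conv_rhs => rw [← hinv t]
  exact (eLpNorm_map_measure hg.aestronglyMeasurable (M.measurable_X t).aemeasurable).symm

theorem MarkovProcess.tendsto_X_zero (M : MarkovProcess Ω E) (ω : Ω) :
    Tendsto (fun t => M.X t ω) (𝓝 0) (𝓝 (M.X 0 ω)) := by
  have := ((M.cadlag ω) 0).1
  have h : Ici (0 : ℝ≥0) = univ := by ext; simp
  rwa [h, continuousWithinAt_univ] at this

variable [PolishSpace E] [BorelSpace E] [IsProbabilityMeasure μs]

/-- For bounded continuous functions this is right continuity of paths plus dominated convergence.
Such functions are dense in `L²`, and stationarity makes the approximation error the same at every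
time. -/
theorem MarkovProcess.IsInvariant.tendsto_eLpNorm_comp_X_sub (hinv : M.IsInvariant μs)
    {g : E → ℝ} (hg : Measurable g) (hg2 : MemLp g 2 μs) :
    Tendsto (fun t => eLpNorm (fun ω => g (M.X t ω) - g (M.X 0 ω)) 2 (M.law μs)) (𝓝 0) (𝓝 0) := by
  rw [ENNReal.tendsto_nhds_zero]
  intro ε hε
  have hε3 : ε / 3 ≠ 0 := by simp [hε.ne']
  obtain ⟨k, hk, -⟩ := hg2.exists_boundedContinuous_eLpNorm_sub_le (by simp) hε3
  have hkm : Measurable k := k.continuous.measurable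
  have hcont : Tendsto (fun t => eLpNorm (fun ω => k (M.X t ω) - k (M.X 0 ω)) 2 (M.law μs))
      (𝓝 0) (𝓝 0) := by
    have h1 : Tendsto (fun t => ∫⁻ ω, ‖k (M.X t ω) - k (M.X 0 ω)‖ₑ ^ 2 ∂(M.law μs))
        (𝓝 0) (𝓝 (∫⁻ _, 0 ∂(M.law μs))) := by
      refine tendsto_lintegral_filter_of_dominated_convergence
        (fun _ => (ENNReal.ofReal (2 * ‖k‖)) ^ 2) (.of_forall fun t => ?_) (.of_forall fun t => ?_)
        (by rw [lintegral_const]; finiteness) (.of_forall fun ω => ?_)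
      · exact ((hkm.comp (M.measurable_X t)).sub (hkm.comp (M.measurable_X 0))).enorm.pow_const 2
      · refine .of_forall fun ω => ENNReal.pow_le_pow_left ?_
        rw [← ofReal_norm, ← dist_eq_norm]
        exact ENNReal.ofReal_le_ofReal (k.dist_le_two_norm _ _)
      · have h2 : Tendsto (fun t => k (M.X t ω) - k (M.X 0 ω)) (𝓝 0) (𝓝 0) := by
          have := ((k.continuous.tendsto _).comp (M.tendsto_X_zero ω)).sub_const (k (M.X 0 ω))
          simpa using this
        simpa [Function.comp_def] using ((ENNReal.continuous_pow 2).tendsto _).comp h2.enorm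
    simp only [lintegral_zero, ← eLpNorm_two_sq] at h1
    have h3 := (ENNReal.continuous_rpow_const (y := 1 / 2)).tendsto 0 |>.comp h1
    simp only [Function.comp_def, ← ENNReal.rpow_natCast, ← ENNReal.rpow_mul] at h3
    simpa using h3
  filter_upwards [ENNReal.tendsto_nhds_zero.1 hcont (ε / 3) (pos_iff_ne_zero.2 hε3)] with t ht
  have hgk : ∀ r, eLpNorm (fun ω => g (M.X r ω) - k (M.X r ω)) 2 (M.law μs) ≤ ε / 3 := fun r =>
    (hinv.eLpNorm_comp_X r (hg.sub hkm)).trans_le hk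
  have hgm : ∀ r, Measurable fun ω => g (M.X r ω) := fun r => hg.comp (M.measurable_X r)
  have hkm' : ∀ r, Measurable fun ω => k (M.X r ω) := fun r => hkm.comp (M.measurable_X r)
  have hsplit : (fun ω => g (M.X t ω) - g (M.X 0 ω)) =
      ((fun ω => g (M.X t ω) - k (M.X t ω)) + fun ω => k (M.X t ω) - k (M.X 0 ω)) -
        fun ω => g (M.X 0 ω) - k (M.X 0 ω) := by
    ext ω
    simp only [Pi.add_apply, Pi.sub_apply]
    ring
  rw [hsplit]
  calc _ ≤ eLpNorm ((fun ω => g (M.X t ω) - k (M.X t ω)) + fun ω => k (M.X t ω) - k (M.X 0 ω)) 2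
          (M.law μs) + eLpNorm (fun ω => g (M.X 0 ω) - k (M.X 0 ω)) 2 (M.law μs) :=
        eLpNorm_sub_le (((hgm t).sub (hkm' t)).add ((hkm' t).sub (hkm' 0))).aestronglyMeasurable
          ((hgm 0).sub (hkm' 0)).aestronglyMeasurable one_le_two
    _ ≤ (ε / 3 + ε / 3) + ε / 3 := by
        refine add_le_add ((eLpNorm_add_le ((hgm t).sub (hkm' t)).aestronglyMeasurable
          ((hkm' t).sub (hkm' 0)).aestronglyMeasurable one_le_two).trans
          (add_le_add (hgk t) ht)) (hgk 0)
    _ = ε := ENNReal.add_thirds ε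

theorem MarkovProcess.measurable_uncurry_X (M : MarkovProcess Ω E) :
    Measurable (fun p : ℝ≥0 × Ω => M.X p.1 p.2) :=
  measurable_uncurry_of_rightContinuous M.measurable_X fun ω t => (M.cadlag ω t).1

theorem MarkovProcess.measurable_occupation (M : MarkovProcess Ω E) {V : E → ℝ}
    (hV : Measurable V) (t : ℝ≥0) : Measurable (occupation V M.X t) :=
  HypoUQ.measurable_occupation M.measurable_X (fun ω t => (M.cadlag ω t).1) hV t

theorem intervalIntegrable_comp {X : ℝ≥0 → Ω → E} (hm : ∀ t, Measurable (X t))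
    (hr : ∀ ω t, ContinuousWithinAt (fun t => X t ω) (Ici t) t) {V : E → ℝ}
    (hV : Measurable V) {K : ℝ} (hK : ∀ x, |V x| ≤ K) (ω : Ω) (a b : ℝ) :
    IntervalIntegrable (fun r => V (X r.toNNReal ω)) volume a b := by
  have hm : Measurable fun r : ℝ => V (X r.toNNReal ω) :=
    hV.comp ((measurable_uncurry_of_rightContinuous hm hr).comp
      (measurable_real_toNNReal.prodMk measurable_const))
  rw [intervalIntegrable_iff]
  exact Measure.integrableOn_of_bounded (M := K) (by simp) hm.aestronglyMeasurable
    (.of_forall fun r => hK _)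

theorem MarkovProcess.intervalIntegrable_comp_X (M : MarkovProcess Ω E) {V : E → ℝ}
    (hV : Measurable V) {K : ℝ} (hK : ∀ x, |V x| ≤ K) (ω : Ω) (a b : ℝ) :
    IntervalIntegrable (fun r => V (M.X r.toNNReal ω)) volume a b :=
  intervalIntegrable_comp M.measurable_X (fun ω t => (M.cadlag ω t).1) hV hK ω a b

/-- As `V` is merely measurable, `r ↦ V (X_r)` need not be right continuous, so the limit is taken
in `L²`. The substitution `r = h τ` turns the error into an average over `τ ∈ (0,1]` of `V (X_{hτ})
- V (X_0)`, uniformly small in `L²`. -/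
theorem MarkovProcess.IsInvariant.tendsto_occupation_div (hinv : M.IsInvariant μs) {V : E → ℝ}
    (hV : Measurable V) {K : ℝ} (hK : ∀ x, |V x| ≤ K) :
    Tendsto (fun h : ℝ≥0 => eLpNorm (fun ω => occupation V M.X h ω / (h : ℝ) - V (M.X 0 ω)) 2
      (M.law μs)) (𝓝[>] 0) (𝓝 0) := by
  have hV2 : MemLp V 2 μs := .of_bound hV.aestronglyMeasurable K (.of_forall hK)
  have h0 := hinv.tendsto_eLpNorm_comp_X_sub hV hV2
  rw [ENNReal.tendsto_nhds_zero] at h0 ⊢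
  intro ε hε
  obtain ⟨δ, hδ, hball⟩ := NNReal.nhds_zero_basis.mem_iff.1 (h0 ε hε)
  have hIio : Iio δ ∈ 𝓝[>] (0 : ℝ≥0) := mem_nhdsWithin_of_mem_nhds (Iio_mem_nhds hδ)
  filter_upwards [hIio, self_mem_nhdsWithin] with h hhδ hh
  have hh0 : (0 : ℝ) < h := hh
  have hprob : IsProbabilityMeasure (volume.restrict (Ioc (0 : ℝ) 1)) := ⟨by simp⟩
  have heq : (fun ω => occupation V M.X h ω / (h : ℝ) - V (M.X 0 ω)) =
      fun ω => ∫ τ in Ioc (0 : ℝ) 1, (V (M.X ((h : ℝ) * τ).toNNReal ω) - V (M.X 0 ω)) := by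
    ext ω
    have hi : IntervalIntegrable (fun τ : ℝ => V (M.X ((h : ℝ) * τ).toNNReal ω)) volume 0 1 := by
      simpa [hh0.ne'] using (M.intervalIntegrable_comp_X hV hK ω 0 h).comp_mul_left (c := (h : ℝ))
    rw [← intervalIntegral.integral_of_le zero_le_one, intervalIntegral.integral_sub hi (by simp),
      intervalIntegral.integral_comp_mul_left (fun r => V (M.X r.toNNReal ω)) hh0.ne']
    simp [occupation, div_eq_inv_mul]
  rw [heq]
  refine eLpNorm_integral_le_of_forall _ _
    (f := fun ω τ => V (M.X ((h : ℝ) * τ).toNNReal ω) - V (M.X 0 ω)) ?_ ?_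
  · refine Measurable.sub ?_ ((hV.comp (M.measurable_X 0)).comp measurable_fst)
    exact hV.comp (M.measurable_uncurry_X.comp
      ((measurable_snd.const_mul (h : ℝ)).real_toNNReal.prodMk measurable_fst))
  · filter_upwards [ae_restrict_mem measurableSet_Ioc] with τ hτ
    refine hball (show _ < δ from lt_of_le_of_lt ?_ hhδ)
    rw [Real.toNNReal_le_iff_le_coe]
    nlinarith [hτ.1, hτ.2]

/-- The occupation integral is at most `K h`, so the remainder `e^y - 1 - y` divided by `h` is at
most `K² h` for small `h`. -/
theorem MarkovProcess.IsInvariant.tendsto_exp_occupation_div (hinv : M.IsInvariant μs) {V : E → ℝ}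
    (hV : Measurable V) {K : ℝ} (hK : ∀ x, |V x| ≤ K) :
    Tendsto (fun h : ℝ≥0 => eLpNorm (fun ω => (Real.exp (occupation V M.X h ω) - 1) / (h : ℝ)
      - V (M.X 0 ω)) 2 (M.law μs)) (𝓝[>] 0) (𝓝 0) := by
  have hI := fun h => M.measurable_occupation hV h
  have hK0 : 0 ≤ K := by
    obtain ⟨ω⟩ := nonempty_of_isProbabilityMeasure (M.law μs)
    exact (abs_nonneg _).trans (hK (M.X 0 ω))
  have h2 : Tendsto (fun h : ℝ≥0 => eLpNorm (fun ω => (Real.exp (occupation V M.X h ω) - 1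
      - occupation V M.X h ω) / (h : ℝ)) 2 (M.law μs)) (𝓝[>] 0) (𝓝 0) := by
    have ha : Tendsto (fun h : ℝ≥0 => ENNReal.ofReal (K ^ 2 * h)) (𝓝[>] 0) (𝓝 0) := by
      have : Continuous fun h : ℝ≥0 => ENNReal.ofReal (K ^ 2 * h) :=
        ENNReal.continuous_ofReal.comp (by fun_prop)
      simpa using (this.tendsto 0).mono_left nhdsWithin_le_nhds
    have hK1 : ∀ᶠ h : ℝ≥0 in 𝓝[>] 0, K * (h : ℝ) ≤ 1 := by
      have : Continuous fun h : ℝ≥0 => K * (h : ℝ) := by fun_prop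
      have h1 := (this.tendsto 0).eventually_le_const (u := (1 : ℝ)) (by simp)
      exact h1.filter_mono nhdsWithin_le_nhds
    refine tendsto_eLpNorm_of_le ha ?_
    filter_upwards [hK1, self_mem_nhdsWithin] with h hh1 hh
    have hh0 : (0 : ℝ) < h := hh
    refine eLpNorm_le_ofReal_of_bound _ fun ω => ?_
    have hb := abs_occupation_le hK M.X h ω
    rw [abs_div, abs_of_pos hh0, div_le_iff₀ hh0]
    refine (Real.abs_exp_sub_one_sub_id_le (hb.trans hh1)).trans ?_
    rw [← sq_abs]
    calc |occupation V M.X h ω| ^ 2 ≤ (K * h) ^ 2 := by gcongr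
      _ = K ^ 2 * h * h := by ring
  refine (tendsto_eLpNorm_add (fun h => ?_) (fun h => ?_)
    (hinv.tendsto_occupation_div hV hK) h2).congr fun h => ?_
  · exact ((hI h).div_const _).sub (hV.comp (M.measurable_X 0))
  · exact (((hI h).exp.sub_const 1).sub (hI h)).div_const _
  · congr 1
    ext ω
    ring

theorem MarkovProcess.IsInvariant.tendsto_exp_occupation_div_mul (hinv : M.IsInvariant μs)
    {V : E → ℝ} (hV : Measurable V) {K : ℝ} (hK : ∀ x, |V x| ≤ K) {g : E → ℝ} (hg : Measurable g)
    {G : ℝ} (hG : ∀ x, |g x| ≤ G) :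
    Tendsto (fun h : ℝ≥0 => eLpNorm (fun ω => (Real.exp (occupation V M.X h ω) - 1) / (h : ℝ)
      * g (M.X h ω) - V (M.X 0 ω) * g (M.X 0 ω)) 2 (M.law μs)) (𝓝[>] 0) (𝓝 0) := by
  have hI := fun h => M.measurable_occupation hV h
  have hX : ∀ {k : E → ℝ}, Measurable k → ∀ t, Measurable fun ω => k (M.X t ω) :=
    fun hk t => hk.comp (M.measurable_X t)
  have hg2 : MemLp g 2 μs := .of_bound hg.aestronglyMeasurable G (.of_forall hG)
  have h1 : Tendsto (fun h : ℝ≥0 => eLpNorm (fun ω => ((Real.exp (occupation V M.X h ω) - 1)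
      / (h : ℝ) - V (M.X 0 ω)) * g (M.X h ω)) 2 (M.law μs)) (𝓝[>] 0) (𝓝 0) := by
    refine tendsto_eLpNorm_of_abs_le_mul (C := G) (fun h ω => ?_)
      (hinv.tendsto_exp_occupation_div hV hK)
    rw [abs_mul, mul_comm]
    exact mul_le_mul_of_nonneg_right (hG _) (abs_nonneg _)
  have h2 : Tendsto (fun h : ℝ≥0 => eLpNorm (fun ω => V (M.X 0 ω) * (g (M.X h ω) - g (M.X 0 ω)))
      2 (M.law μs)) (𝓝[>] 0) (𝓝 0) := by
    refine tendsto_eLpNorm_of_abs_le_mul (C := K) (fun h ω => ?_)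
      ((hinv.tendsto_eLpNorm_comp_X_sub hg hg2).mono_left nhdsWithin_le_nhds)
    rw [abs_mul]
    exact mul_le_mul_of_nonneg_right (hK _) (abs_nonneg _)
  refine (tendsto_eLpNorm_add (fun h => ?_) (fun h => ?_) h1 h2).congr fun h => ?_
  · exact ((((hI h).exp.sub_const 1).div_const _).sub (hX hV 0)).mul (hX hg h)
  · exact (hX hV 0).mul ((hX hg h).sub (hX hg 0))
  · congr 1
    ext ω
    ring

end SmallTime

/-! ### The Feynman–Kac semigroup and mean additive functionals: cocycle identities, right
derivatives, domain of the generator. -/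

section FeynmanKac

variable {Ω E : Type*} [MeasurableSpace Ω] [TopologicalSpace E] [MeasurableSpace E]

/-- The Feynman–Kac semigroup `E^x[exp(∫₀ᵗ V(X_r) dr) g(X_t)]`. -/
noncomputable def MarkovProcess.feynmanKac (M : MarkovProcess Ω E) (V : E → ℝ) (t : ℝ≥0)
    (g : E → ℝ) (x : E) : ℝ :=
  ∫ ω, Real.exp (occupation V M.X t ω) * g (M.X t ω) ∂(M.P x)

/-- The mean additive functional `E^x[∫₀ᵗ φ(X_r) dr]`. -/
noncomputable def MarkovProcess.meanOccupation (M : MarkovProcess Ω E) (φ : E → ℝ) (t : ℝ≥0)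
    (x : E) : ℝ :=
  ∫ ω, occupation φ M.X t ω ∂(M.P x)

theorem abs_integral_le_of_forall {α : Type*} [MeasurableSpace α] (m : Measure α)
    [IsProbabilityMeasure m] {f : α → ℝ} {C : ℝ} (h : ∀ x, |f x| ≤ C) : |∫ x, f x ∂m| ≤ C := by
  have := norm_integral_le_of_norm_le_const (μ := m) (f := f) (C := C) (.of_forall h)
  simpa using this

theorem MarkovProcess.abs_semigroup_le (M : MarkovProcess Ω E) {g : E → ℝ} {G : ℝ}
    (hG : ∀ x, |g x| ≤ G) (t : ℝ≥0) (x : E) : |M.semigroup t g x| ≤ G :=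
  abs_integral_le_of_forall _ fun _ => hG _

theorem MarkovProcess.measurable_semigroup (M : MarkovProcess Ω E) {g : E → ℝ}
    (hg : Measurable g) (t : ℝ≥0) : Measurable (M.semigroup t g) :=
  (hg.comp (M.measurable_X t)).stronglyMeasurable.integral_kernel.measurable

theorem MarkovProcess.integrable_comp_X (M : MarkovProcess Ω E) {g : E → ℝ} (hg : Measurable g)
    {G : ℝ} (hG : ∀ x, |g x| ≤ G) (t : ℝ≥0) (x : E) :
    Integrable (fun ω => g (M.X t ω)) (M.P x) :=
  .of_bound (hg.comp (M.measurable_X t)).aestronglyMeasurable G (.of_forall fun _ => hG _)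

theorem MarkovProcess.semigroup_sub (M : MarkovProcess Ω E) {g k : E → ℝ} (hg : Measurable g)
    {G : ℝ} (hG : ∀ x, |g x| ≤ G) (hk : Measurable k) {G' : ℝ} (hG' : ∀ x, |k x| ≤ G')
    (t : ℝ≥0) (x : E) :
    M.semigroup t (fun y => g y - k y) x = M.semigroup t g x - M.semigroup t k x :=
  integral_sub (M.integrable_comp_X hg hG t x) (M.integrable_comp_X hk hG' t x)

theorem exp_occupation_le {V : E → ℝ} {K : ℝ} (hK : ∀ x, |V x| ≤ K) (X : ℝ≥0 → Ω → E) (t : ℝ≥0)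
    (ω : Ω) : Real.exp (occupation V X t ω) ≤ Real.exp (K * t) :=
  Real.exp_le_exp.2 ((le_abs_self _).trans (abs_occupation_le hK X t ω))

variable [PolishSpace E] [BorelSpace E] (M : MarkovProcess Ω E) {μs : Measure E}
  {V : E → ℝ} {K : ℝ}

theorem MarkovProcess.measurable_feynmanKac (hV : Measurable V) {g : E → ℝ} (hg : Measurable g)
    (t : ℝ≥0) : Measurable (M.feynmanKac V t g) :=
  ((M.measurable_occupation hV t).exp.mul
    (hg.comp (M.measurable_X t))).stronglyMeasurable.integral_kernel.measurable

theorem MarkovProcess.measurable_meanOccupation (hV : Measurable V) (t : ℝ≥0) :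
    Measurable (M.meanOccupation V t) :=
  (M.measurable_occupation hV t).stronglyMeasurable.integral_kernel.measurable

theorem MarkovProcess.abs_feynmanKac_le (hK : ∀ x, |V x| ≤ K) {g : E → ℝ} {G : ℝ}
    (hG : ∀ x, |g x| ≤ G) (t : ℝ≥0) (x : E) :
    |M.feynmanKac V t g x| ≤ Real.exp (K * t) * G := by
  refine abs_integral_le_of_forall _ fun ω => ?_
  rw [abs_mul, Real.abs_exp]
  exact mul_le_mul (exp_occupation_le hK _ _ _) (hG _) (abs_nonneg _) (Real.exp_pos _).le

theorem MarkovProcess.abs_meanOccupation_le (hK : ∀ x, |V x| ≤ K) (t : ℝ≥0) (x : E) :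
    |M.meanOccupation V t x| ≤ K * t :=
  abs_integral_le_of_forall _ fun _ => abs_occupation_le hK _ _ _

theorem MarkovProcess.integrable_exp_occupation_mul (hV : Measurable V) (hK : ∀ x, |V x| ≤ K)
    {g : E → ℝ} (hg : Measurable g) {G : ℝ} (hG : ∀ x, |g x| ≤ G) (t : ℝ≥0) (x : E) :
    Integrable (fun ω => Real.exp (occupation V M.X t ω) * g (M.X t ω)) (M.P x) := by
  refine .of_bound ((M.measurable_occupation hV t).exp.mul
    (hg.comp (M.measurable_X t))).aestronglyMeasurable (Real.exp (K * t) * G)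
    (.of_forall fun ω => ?_)
  rw [Real.norm_eq_abs, abs_mul, Real.abs_exp]
  exact mul_le_mul (exp_occupation_le hK _ _ _) (hG _) (abs_nonneg _) (Real.exp_pos _).le

theorem MarkovProcess.feynmanKac_sub (hV : Measurable V) (hK : ∀ x, |V x| ≤ K) {g k : E → ℝ}
    (hg : Measurable g) {G : ℝ} (hG : ∀ x, |g x| ≤ G) (hk : Measurable k) {G' : ℝ}
    (hG' : ∀ x, |k x| ≤ G') (t : ℝ≥0) (x : E) :
    M.feynmanKac V t (fun y => g y - k y) x = M.feynmanKac V t g x - M.feynmanKac V t k x := by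
  unfold feynmanKac
  rw [← integral_sub (M.integrable_exp_occupation_mul hV hK hg hG t x)
    (M.integrable_exp_occupation_mul hV hK hk hG' t x)]
  simp_rw [mul_sub]

theorem MarkovProcess.occupation_add (hV : Measurable V) (hK : ∀ x, |V x| ≤ K) (s t : ℝ≥0)
    (ω : Ω) : occupation V M.X (s + t) ω =
      occupation V M.X s ω + occupation V (fun r => M.X (s + r)) t ω := by
  have h1 : occupation V (fun r => M.X (s + r)) t ω =
      ∫ r in (0 : ℝ)..t, V (M.X ((s : ℝ) + r).toNNReal ω) := by
    refine intervalIntegral.integral_congr fun r hr => ?_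
    rw [uIcc_of_le t.coe_nonneg] at hr
    simp only [Real.toNNReal_add s.coe_nonneg hr.1, Real.toNNReal_coe]
  rw [h1, intervalIntegral.integral_comp_add_left (fun r => V (M.X r.toNNReal ω)), occupation,
    occupation, add_zero, NNReal.coe_add, intervalIntegral.integral_add_adjacent_intervals
      (M.intervalIntegrable_comp_X hV hK ω _ _) (M.intervalIntegrable_comp_X hV hK ω _ _)]

/-- The integral up to time `s` factors through the path on `[0,s]`, which is `𝓕_s`-measurable
evaluation by evaluation. -/
theorem MarkovProcess.measurable_occupation_filtration (hV : Measurable V) (s : ℝ≥0) :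
    Measurable[M.filtration s] (occupation V M.X s) := by
  have h1 : Measurable[M.filtration s] (pathMap M.X M.cadlag s) := by
    have h : Measurable[M.filtration s] (fun ω => fun t : Icc (0 : ℝ≥0) s => M.X t ω) :=
      @measurable_pi_lambda _ _ _ (M.filtration s) _ _ fun t =>
        (M.adapted t).mono (M.filtration.mono t.2.2) le_rfl
    exact @Measurable.subtype_mk _ _ (M.filtration s) _ _ _ h fun ω => (M.cadlag ω).restrict s
  have h2 : occupation V M.X s = fun ω => pathOccupation V (pathMap M.X M.cadlag s ω) :=
    funext fun ω => (pathOccupation_pathMap V M.X M.cadlag s ω).symm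
  rw [h2]
  exact (measurable_pathOccupation hV s).comp h1

/-- The Markov property with the `𝓕_s`-measurable weight `exp ∫₀ˢ V` and the functional `exp ∫₀ᵗ V`
of the shifted path. -/
theorem MarkovProcess.feynmanKac_one_add (hV : Measurable V) (hK : ∀ x, |V x| ≤ K) (s t : ℝ≥0)
    (x : E) : M.feynmanKac V (s + t) (fun _ => 1) x =
      M.feynmanKac V s (M.feynmanKac V t fun _ => 1) x := by
  have h := M.integral_mul_pathMap_shift x s t
    (M.measurable_occupation_filtration hV s).exp (fun _ => (Real.exp_pos _).le)
    (exp_occupation_le hK M.X s) (measurable_pathOccupation hV t).exp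
    (K := Real.exp (K * t)) (fun y => by
      rw [Real.abs_exp]
      exact Real.exp_le_exp.2 ((le_abs_self _).trans (abs_pathOccupation_le hK y)))
  simp_rw [pathOccupation_pathMap, ← Real.exp_add, ← M.occupation_add hV hK] at h
  simpa [feynmanKac] using h

theorem MarkovProcess.meanOccupation_add (hV : Measurable V) (hK : ∀ x, |V x| ≤ K) (s t : ℝ≥0)
    (x : E) : M.meanOccupation V (s + t) x =
      M.meanOccupation V s x + M.semigroup s (M.meanOccupation V t) x := by
  have h := M.integral_mul_pathMap_shift x s t (Z := fun _ => 1)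
    (@measurable_const _ _ _ (M.filtration s) _) (fun _ => zero_le_one) (fun _ => le_rfl)
    (measurable_pathOccupation hV t) (abs_pathOccupation_le hK)
  simp_rw [pathOccupation_pathMap, one_mul] at h
  have hm : Measurable (occupation V (fun r => M.X (s + r)) t) :=
    HypoUQ.measurable_occupation (fun r => M.measurable_X _)
      (fun ω r => (((M.cadlag ω).shift s) r).1) hV t
  have hi : Integrable (occupation V (fun r => M.X (s + r)) t) (M.P x) :=
    .of_bound hm.aestronglyMeasurable (K * t) (.of_forall fun ω => abs_occupation_le hK _ _ _)
  have hi' : Integrable (occupation V M.X s) (M.P x) :=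
    .of_bound (M.measurable_occupation hV s).aestronglyMeasurable (K * s)
      (.of_forall fun ω => abs_occupation_le hK _ _ _)
  unfold meanOccupation semigroup
  rw [← h, ← integral_add hi' hi]
  simp_rw [M.occupation_add hV hK]

variable {M} [IsProbabilityMeasure μs]

theorem MarkovProcess.IsInvariant.eLpNorm_semigroup_le (hinv : M.IsInvariant μs) {g : E → ℝ}
    (hg : Measurable g) (t : ℝ≥0) : eLpNorm (M.semigroup t g) 2 μs ≤ eLpNorm g 2 μs := by
  rw [← hinv.eLpNorm_comp_X t hg]
  exact eLpNorm_integral_kernel_le μs M.P (hg.comp (M.measurable_X t))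

theorem MarkovProcess.IsInvariant.eLpNorm_feynmanKac_le (hinv : M.IsInvariant μs)
    (hV : Measurable V) (hK : ∀ x, |V x| ≤ K) {g : E → ℝ} (hg : Measurable g) (t : ℝ≥0) :
    eLpNorm (M.feynmanKac V t g) 2 μs ≤ ENNReal.ofReal (Real.exp (K * t)) * eLpNorm g 2 μs := by
  rw [← hinv.eLpNorm_comp_X t hg]
  refine (eLpNorm_integral_kernel_le μs M.P ((M.measurable_occupation hV t).exp.mul
    (hg.comp (M.measurable_X t)))).trans ?_
  refine eLpNorm_le_mul_eLpNorm_of_ae_le_mul (.of_forall fun ω => ?_) 2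
  simp only [Pi.mul_apply, Function.comp_apply]
  rw [norm_mul, Real.norm_eq_abs, Real.abs_exp]
  exact mul_le_mul_of_nonneg_right (exp_occupation_le hK _ _ _) (norm_nonneg _)

/-- Transfer of small-time `L²` limits from path space to state space. -/
theorem MarkovProcess.tendsto_eLpNorm_integral_sub {l : Filter ℝ≥0} {Z : ℝ≥0 → Ω → ℝ}
    (hZ : ∀ h, Measurable (Z h)) (hZi : ∀ h x, Integrable (Z h) (M.P x)) {k : E → ℝ}
    (hk : Measurable k)
    (hlim : Tendsto (fun h => eLpNorm (fun ω => Z h ω - k (M.X 0 ω)) 2 (M.law μs)) l (𝓝 0)) :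
    Tendsto (fun h => eLpNorm (fun x => ∫ ω, Z h ω ∂(M.P x) - k x) 2 μs) l (𝓝 0) := by
  refine tendsto_eLpNorm_of_le hlim (.of_forall fun h => ?_)
  have h0 : ∀ x, (fun ω => k (M.X 0 ω)) =ᵐ[M.P x] fun _ => k x := fun x =>
    (M.ae_X_zero x).mono fun ω hω => by simp only [hω]
  have heq : (fun x => ∫ ω, Z h ω ∂(M.P x) - k x) =
      fun x => ∫ ω, (Z h ω - k (M.X 0 ω)) ∂(M.P x) := by
    ext x
    rw [integral_sub (hZi h x) ((integrable_const (k x)).congr (h0 x).symm),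
      integral_congr_ae (h0 x)]
    simp
  rw [heq]
  exact eLpNorm_integral_kernel_le μs M.P ((hZ h).sub (hk.comp (M.measurable_X 0)))

theorem MarkovProcess.IsInvariant.tendsto_meanOccupation_div (hinv : M.IsInvariant μs)
    (hV : Measurable V) (hK : ∀ x, |V x| ≤ K) :
    Tendsto (fun h : ℝ≥0 => eLpNorm (fun x => M.meanOccupation V h x / (h : ℝ) - V x) 2 μs)
      (𝓝[>] 0) (𝓝 0) := by
  have := tendsto_eLpNorm_integral_sub (M := M) (μs := μs)
    (Z := fun h ω => occupation V M.X h ω / (h : ℝ))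
    (fun h => (M.measurable_occupation hV h).div_const _)
    (fun h x => Integrable.div_const (.of_bound
      (M.measurable_occupation hV h).aestronglyMeasurable (K * h)
      (.of_forall fun ω => abs_occupation_le hK _ _ _)) _) hV
    (hinv.tendsto_occupation_div hV hK)
  simpa only [integral_div, meanOccupation] using this

/-- Comparing the two semigroups isolates the potential: the limit exists for every bounded
measurable `g`, whether or not `g` lies in the domain of the generator. -/
theorem MarkovProcess.IsInvariant.tendsto_feynmanKac_sub_semigroup_div (hinv : M.IsInvariant μs)
    (hV : Measurable V) (hK : ∀ x, |V x| ≤ K) {g : E → ℝ} (hg : Measurable g) {G : ℝ}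
    (hG : ∀ x, |g x| ≤ G) :
    Tendsto (fun h : ℝ≥0 => eLpNorm (fun x =>
      (M.feynmanKac V h g x - M.semigroup h g x) / (h : ℝ) - V x * g x) 2 μs)
      (𝓝[>] 0) (𝓝 0) := by
  have hi : ∀ (h : ℝ≥0) x, Integrable (fun ω => Real.exp (occupation V M.X h ω) * g (M.X h ω)
      - g (M.X h ω)) (M.P x) := fun h x =>
    (M.integrable_exp_occupation_mul hV hK hg hG h x).sub (M.integrable_comp_X hg hG h x)
  have heq : ∀ (h : ℝ≥0), (fun ω => (Real.exp (occupation V M.X h ω) - 1) / (h : ℝ)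
      * g (M.X h ω)) = fun ω => (Real.exp (occupation V M.X h ω) * g (M.X h ω)
      - g (M.X h ω)) / (h : ℝ) := fun h => by ext ω; ring
  have := tendsto_eLpNorm_integral_sub (M := M) (μs := μs)
    (Z := fun h ω => (Real.exp (occupation V M.X h ω) - 1) / (h : ℝ) * g (M.X h ω))
    (fun h => (((M.measurable_occupation hV h).exp.sub_const 1).div_const _).mul
      (hg.comp (M.measurable_X h)))
    (fun h x => by
      simp only [heq]
      exact (hi h x).div_const _) (hV.mul hg)
    (hinv.tendsto_exp_occupation_div_mul hV hK hg hG)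
  refine this.congr fun h => ?_
  congr 1
  ext x
  simp only [heq, Pi.mul_apply]
  rw [integral_div, integral_sub (M.integrable_exp_occupation_mul hV hK hg hG h x)
    (M.integrable_comp_X hg hG h x)]
  rfl

theorem MarkovProcess.semigroup_const (c : ℝ) (t : ℝ≥0) (x : E) :
    M.semigroup t (fun _ => c) x = c := by simp [semigroup]

theorem MarkovProcess.IsInvariant.tendsto_feynmanKac_one_sub_one_div (hinv : M.IsInvariant μs)
    (hV : Measurable V) (hK : ∀ x, |V x| ≤ K) :
    Tendsto (fun h : ℝ≥0 => eLpNorm (fun x =>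
      (M.feynmanKac V h (fun _ => 1) x - 1) / (h : ℝ) - V x) 2 μs) (𝓝[>] 0) (𝓝 0) := by
  simpa [semigroup_const] using hinv.tendsto_feynmanKac_sub_semigroup_div hV hK
    (measurable_const (a := (1 : ℝ))) (G := 1) (by simp)

/-- The right derivative of `t ↦ E^x[exp(∫₀ᵗ V(X_r) dr)]` in `L²`. -/
theorem MarkovProcess.IsInvariant.tendsto_feynmanKac_one_slope (hinv : M.IsInvariant μs)
    (hV : Measurable V) (hK : ∀ x, |V x| ≤ K) (t : ℝ≥0) :
    Tendsto (fun h : ℝ≥0 => eLpNorm (fun x => (M.feynmanKac V (t + h) (fun _ => 1) x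
      - M.feynmanKac V t (fun _ => 1) x) / (h : ℝ) - M.feynmanKac V t V x) 2 μs)
      (𝓝[>] 0) (𝓝 0) := by
  have hone : ∀ x : E, |(fun _ => (1 : ℝ)) x| ≤ 1 := by simp
  have hlim := hinv.tendsto_feynmanKac_one_sub_one_div hV hK
  have hm := fun h => M.measurable_feynmanKac hV (measurable_const (a := (1 : ℝ))) h
  refine tendsto_eLpNorm_of_le (a := fun h : ℝ≥0 => ENNReal.ofReal (Real.exp (K * t)) *
    eLpNorm (fun x => (M.feynmanKac V h (fun _ => 1) x - 1) / (h : ℝ) - V x) 2 μs) ?_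
    (.of_forall fun h => ?_)
  · simpa using ENNReal.Tendsto.const_mul hlim (.inr ENNReal.ofReal_ne_top)
  -- The error of the slope at `t` is the bounded operator `P^V_t` applied to the error of the slope
  -- at `0`.
  · refine le_of_eq_of_le ?_ (hinv.eLpNorm_feynmanKac_le hV hK
      ((((hm h).sub_const 1).div_const _).sub hV) t)
    congr 1
    ext x
    have e1 : ∀ k : E → ℝ, M.feynmanKac V t (fun x => k x / (h : ℝ)) x =
        M.feynmanKac V t k x / (h : ℝ) := fun k => by
      simp only [feynmanKac, ← integral_div, mul_div_assoc]
    have hb1 := M.abs_feynmanKac_le hK hone h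
    have hb2 : ∀ x, |M.feynmanKac V h (fun _ => 1) x - 1| ≤ Real.exp (K * h) * 1 + 1 := fun x =>
      (abs_sub _ _).trans (add_le_add (hb1 x) (by simp))
    change _ = M.feynmanKac V t (fun x => (M.feynmanKac V h (fun _ => 1) x - 1) / (h : ℝ) - V x) x
    rw [M.feynmanKac_sub hV hK (((hm h).sub_const 1).div_const _)
      (G := (Real.exp (K * h) * 1 + 1) / h) (fun x => by
        rw [abs_div, abs_of_nonneg h.coe_nonneg]
        exact div_le_div_of_nonneg_right (hb2 x) h.coe_nonneg) hV hK, e1,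
      M.feynmanKac_sub hV hK (hm h) hb1 measurable_const hone, M.feynmanKac_one_add hV hK]

/-- This puts `u_t = P^V_t 1` in the domain of the generator with `A u_t = P^V_t V - V u_t`. The
increment `u_{t+h} - u_t` is also `P^V_h u_t - u_t`; its slope is known, and subtracting the limit
`V u_t` of the perturbation leaves the slope of the unperturbed semigroup. -/
theorem MarkovProcess.IsInvariant.tendsto_semigroup_feynmanKac_one (hinv : M.IsInvariant μs)
    (hV : Measurable V) (hK : ∀ x, |V x| ≤ K) (t : ℝ≥0) :
    Tendsto (fun h : ℝ≥0 => eLpNorm (fun x => (M.semigroup h (M.feynmanKac V t fun _ => 1) x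
      - M.feynmanKac V t (fun _ => 1) x) / (h : ℝ)
      - (M.feynmanKac V t V x - V x * M.feynmanKac V t (fun _ => 1) x)) 2 μs)
      (𝓝[>] 0) (𝓝 0) := by
  have hone : ∀ x : E, |(fun _ => (1 : ℝ)) x| ≤ 1 := by simp
  have hm := fun h => M.measurable_feynmanKac hV (measurable_const (a := (1 : ℝ))) h
  have h1 := hinv.tendsto_feynmanKac_one_slope hV hK t
  have h2 := hinv.tendsto_feynmanKac_sub_semigroup_div hV hK (hm t)
    (M.abs_feynmanKac_le hK hone t)
  have h2' : Tendsto (fun h : ℝ≥0 => eLpNorm (fun x =>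
      -((M.feynmanKac V h (M.feynmanKac V t fun _ => 1) x
        - M.semigroup h (M.feynmanKac V t fun _ => 1) x) / (h : ℝ)
        - V x * M.feynmanKac V t (fun _ => 1) x)) 2 μs) (𝓝[>] 0) (𝓝 0) :=
    tendsto_eLpNorm_of_abs_le_mul (C := 1) (fun h x => by rw [abs_neg, one_mul]) h2
  refine (tendsto_eLpNorm_add (fun h => ?_) (fun h => ?_) h1 h2').congr fun h => ?_
  · exact (((hm _).sub (hm _)).div_const _).sub (M.measurable_feynmanKac hV hV t)
  · exact ((((M.measurable_feynmanKac hV (hm t) h).sub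
      (M.measurable_semigroup (hm t) h)).div_const _).sub (hV.mul (hm t))).neg
  · congr 1
    ext x
    rw [add_comm t h, M.feynmanKac_one_add hV hK h t]
    ring

/-- The right derivative of `t ↦ E^x[∫₀ᵗ V(X_r) dr]` in `L²`. -/
theorem MarkovProcess.IsInvariant.tendsto_meanOccupation_slope (hinv : M.IsInvariant μs)
    (hV : Measurable V) (hK : ∀ x, |V x| ≤ K) (t : ℝ≥0) :
    Tendsto (fun h : ℝ≥0 => eLpNorm (fun x => (M.meanOccupation V (t + h) x
      - M.meanOccupation V t x) / (h : ℝ) - M.semigroup t V x) 2 μs) (𝓝[>] 0) (𝓝 0) := by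
  have hm := fun h => M.measurable_meanOccupation hV h
  refine tendsto_eLpNorm_of_le (hinv.tendsto_meanOccupation_div hV hK) (.of_forall fun h => ?_)
  refine le_of_eq_of_le ?_ (hinv.eLpNorm_semigroup_le (((hm h).div_const _).sub hV) t)
  congr 1
  ext x
  change _ = M.semigroup t (fun x => M.meanOccupation V h x / (h : ℝ) - V x) x
  rw [M.semigroup_sub ((hm h).div_const _) (G := K * h / h) (fun x => by
      rw [abs_div, abs_of_nonneg h.coe_nonneg]
      exact div_le_div_of_nonneg_right (M.abs_meanOccupation_le hK h x) h.coe_nonneg) hV hK,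
    M.meanOccupation_add hV hK, add_sub_cancel_left]
  simp only [semigroup, integral_div]

/-- The identity `A ∫₀ᵗ P_r V dr = P_t V - V`, read off from the two ways of splitting the time
interval `t + h`. -/
theorem MarkovProcess.IsInvariant.tendsto_semigroup_meanOccupation (hinv : M.IsInvariant μs)
    (hV : Measurable V) (hK : ∀ x, |V x| ≤ K) (t : ℝ≥0) :
    Tendsto (fun h : ℝ≥0 => eLpNorm (fun x => (M.semigroup h (M.meanOccupation V t) x
      - M.meanOccupation V t x) / (h : ℝ) - (M.semigroup t V x - V x)) 2 μs)
      (𝓝[>] 0) (𝓝 0) := by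
  have hm := fun h => M.measurable_meanOccupation hV h
  have h1 := hinv.tendsto_meanOccupation_slope hV hK t
  have h2' : Tendsto (fun h : ℝ≥0 => eLpNorm (fun x =>
      -(M.meanOccupation V h x / (h : ℝ) - V x)) 2 μs) (𝓝[>] 0) (𝓝 0) :=
    tendsto_eLpNorm_of_abs_le_mul (C := 1) (fun h x => by rw [abs_neg, one_mul])
      (hinv.tendsto_meanOccupation_div hV hK)
  refine (tendsto_eLpNorm_add (fun h => ?_) (fun h => ?_) h1 h2').congr fun h => ?_
  · exact (((hm _).sub (hm _)).div_const _).sub (M.measurable_semigroup hV t)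
  · exact (((hm h).div_const _).sub hV).neg
  · congr 1
    ext x
    rw [add_comm t h, M.meanOccupation_add hV hK h t]
    ring

theorem abs_exp_sub_one_le_exp_abs_sub_one (y : ℝ) : |Real.exp y - 1| ≤ Real.exp |y| - 1 := by
  have h1 := Real.add_one_le_exp y
  have h2 := Real.add_one_le_exp (-y)
  rcases le_total 0 y with h | h
  · rw [abs_of_nonneg h, abs_of_nonneg (by linarith)]
  · rw [abs_of_nonpos h, abs_of_nonpos (by linarith [Real.exp_le_one_iff.2 h])]
    linarith

/-- For `s ≤ t = s + h` the difference is `P^V_s (P^V_h 1 - 1)`. The bound, an increment of one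
continuous function of time, is what continuity of the curve in `L²` requires. -/
theorem MarkovProcess.abs_feynmanKac_one_sub_le (hV : Measurable V) (hK : ∀ x, |V x| ≤ K)
    (s t : ℝ≥0) (x : E) : |M.feynmanKac V t (fun _ => 1) x - M.feynmanKac V s (fun _ => 1) x| ≤
      |Real.exp (K * t) - Real.exp (K * s)| := by
  wlog hst : s ≤ t generalizing s t
  · rw [abs_sub_comm, abs_sub_comm (Real.exp _)]
    exact this t s (le_of_not_ge hst)
  obtain ⟨h, rfl⟩ := exists_add_of_le hst
  have hone : ∀ x : E, |(fun _ => (1 : ℝ)) x| ≤ 1 := by simp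
  have h1 : ∀ y, |M.feynmanKac V h (fun _ => 1) y - 1| ≤ Real.exp (K * h) - 1 := by
    intro y
    have heq : M.feynmanKac V h (fun _ => 1) y - 1 =
        ∫ ω, (Real.exp (occupation V M.X h ω) * 1 - 1) ∂(M.P y) := by
      rw [integral_sub (M.integrable_exp_occupation_mul hV hK measurable_const hone h y)
        (integrable_const 1)]
      simp [feynmanKac]
    rw [heq]
    refine abs_integral_le_of_forall _ fun ω => ?_
    rw [mul_one]
    exact (abs_exp_sub_one_le_exp_abs_sub_one _).trans
      (sub_le_sub_right (Real.exp_le_exp.2 (abs_occupation_le hK _ _ _)) 1)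
  have hm := M.measurable_feynmanKac hV (measurable_const (a := (1 : ℝ))) h
  rw [M.feynmanKac_one_add hV hK, ← M.feynmanKac_sub hV hK hm (M.abs_feynmanKac_le hK hone h)
    measurable_const hone]
  refine (M.abs_feynmanKac_le hK h1 s x).trans (le_of_eq_of_le ?_ (le_abs_self _))
  rw [NNReal.coe_add, mul_add, Real.exp_add]
  ring

theorem MarkovProcess.abs_meanOccupation_sub_le (hV : Measurable V) (hK : ∀ x, |V x| ≤ K)
    (s t : ℝ≥0) (x : E) : |M.meanOccupation V t x - M.meanOccupation V s x| ≤
      |K * t - K * s| := by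
  wlog hst : s ≤ t generalizing s t
  · rw [abs_sub_comm, abs_sub_comm (K * _)]
    exact this t s (le_of_not_ge hst)
  obtain ⟨h, rfl⟩ := exists_add_of_le hst
  rw [M.meanOccupation_add hV hK, add_sub_cancel_left]
  refine (M.abs_semigroup_le (M.abs_meanOccupation_le hK h) s x).trans
    (le_of_eq_of_le ?_ (le_abs_self _))
  rw [NNReal.coe_add]
  ring

end FeynmanKac

/-! ### From pointwise representatives to differentiable curves in `L²`. -/

section Curves

variable {E : Type*} [MeasurableSpace E] {μs : Measure E}

theorem hasDerivWithinAt_toLp {u : ℝ≥0 → E → ℝ} (hu : ∀ t, MemLp (u t) 2 μs) {k : E → ℝ}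
    (hk : MemLp k 2 μs) (t : ℝ≥0)
    (h : Tendsto (fun h : ℝ≥0 => eLpNorm (fun x => (u (t + h) x - u t x) / (h : ℝ) - k x) 2 μs)
      (𝓝[>] 0) (𝓝 0)) :
    HasDerivWithinAt (fun r : ℝ => (hu r.toNNReal).toLp (u r.toNNReal)) (hk.toLp k)
      (Ici (t : ℝ)) t := by
  rw [← hasDerivWithinAt_Ioi_iff_Ici, hasDerivWithinAt_iff_tendsto_slope' self_notMem_Ioi,
    tendsto_iff_norm_sub_tendsto_zero]
  have hshift : Tendsto (fun r : ℝ => (r - t).toNNReal) (𝓝[>] (t : ℝ)) (𝓝[>] 0) := by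
    refine tendsto_nhdsWithin_iff.2 ⟨?_, ?_⟩
    · have : Continuous fun r : ℝ => (r - t).toNNReal := by fun_prop
      simpa using (this.tendsto (t : ℝ)).mono_left nhdsWithin_le_nhds
    · filter_upwards [self_mem_nhdsWithin] with r hr
      simpa using hr
  have h2 := (ENNReal.tendsto_toReal ENNReal.zero_ne_top).comp (h.comp hshift)
  rw [ENNReal.toReal_zero] at h2
  refine h2.congr' ?_
  filter_upwards [self_mem_nhdsWithin] with r hr
  have hr' : (t : ℝ) < r := hr
  have hrt : r.toNNReal = t + (r - t).toNNReal := by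
    rw [← NNReal.coe_inj, NNReal.coe_add, Real.coe_toNNReal _ (sub_nonneg.2 hr'.le),
      Real.coe_toNNReal _ (t.coe_nonneg.trans hr'.le)]
    ring
  rw [Lp.norm_def]
  simp only [Function.comp_apply]
  congr 1
  refine eLpNorm_congr_ae ?_
  rw [slope_def_module]
  filter_upwards [Lp.coeFn_sub ((r - t)⁻¹ • ((hu r.toNNReal).toLp (u r.toNNReal) -
      (hu (t : ℝ).toNNReal).toLp (u (t : ℝ).toNNReal))) (hk.toLp k),
    Lp.coeFn_smul (r - t)⁻¹ ((hu r.toNNReal).toLp (u r.toNNReal) -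
      (hu (t : ℝ).toNNReal).toLp (u (t : ℝ).toNNReal)),
    Lp.coeFn_sub ((hu r.toNNReal).toLp (u r.toNNReal))
      ((hu (t : ℝ).toNNReal).toLp (u (t : ℝ).toNNReal)), (hu r.toNNReal).coeFn_toLp,
    (hu (t : ℝ).toNNReal).coeFn_toLp, hk.coeFn_toLp] with x h1 h2 h3 h4 h5 h6
  rw [h1, Pi.sub_apply, h2, Pi.smul_apply, h3, Pi.sub_apply, h4, h5, h6, smul_eq_mul, ← hrt,
    Real.coe_toNNReal _ (sub_nonneg.2 hr'.le), Real.toNNReal_coe]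
  ring

theorem continuous_toLp [IsProbabilityMeasure μs] {u : ℝ≥0 → E → ℝ} (hu : ∀ t, MemLp (u t) 2 μs)
    {m : ℝ≥0 → ℝ} (hm : Continuous m) (h : ∀ s t x, |u t x - u s x| ≤ |m t - m s|) :
    Continuous (fun r : ℝ => (hu r.toNNReal).toLp (u r.toNNReal)) := by
  rw [continuous_iff_continuousAt]
  intro s
  rw [ContinuousAt, tendsto_iff_norm_sub_tendsto_zero]
  have hlim : Tendsto (fun r : ℝ => |m r.toNNReal - m s.toNNReal|) (𝓝 s) (𝓝 0) := by
    have : Continuous fun r : ℝ => |m r.toNNReal - m s.toNNReal| := by fun_prop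
    simpa using this.tendsto s
  refine squeeze_zero (fun _ => norm_nonneg _) (fun r => ?_) hlim
  rw [← MemLp.toLp_sub, Lp.norm_toLp]
  exact ENNReal.toReal_le_of_le_ofReal (abs_nonneg _) (eLpNorm_le_ofReal_of_bound _ (h _ _))

/-- The Grönwall estimate in the form met by both curves: functions indexed by nonnegative time,
with only the right derivatives that the small-time limits supply. -/
theorem sqrt_form_toLp_le_gronwallBound [IsProbabilityMeasure μs]
    (B : Lp ℝ 2 μs →L[ℝ] Lp ℝ 2 μs →L[ℝ] ℝ) (hsymm : ∀ x y, B x y = B y x)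
    (hnn : ∀ x, 0 ≤ B x x) {u k : ℝ≥0 → E → ℝ} (hu : ∀ t, MemLp (u t) 2 μs)
    (hk : ∀ t, MemLp (k t) 2 μs) {m : ℝ≥0 → ℝ} (hm : Continuous m)
    (hum : ∀ s t x, |u t x - u s x| ≤ |m t - m s|)
    (hder : ∀ t, Tendsto (fun h : ℝ≥0 =>
      eLpNorm (fun x => (u (t + h) x - u t x) / (h : ℝ) - k t x) 2 μs) (𝓝[>] 0) (𝓝 0))
    {κ β : ℝ} (hβ : 0 ≤ β)
    (hB : ∀ t, B ((hk t).toLp (k t)) ((hu t).toLp (u t)) ≤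
      κ * B ((hu t).toLp (u t)) ((hu t).toLp (u t)) +
        β * √(B ((hu t).toLp (u t)) ((hu t).toLp (u t)))) (T : ℝ≥0) :
    √(B ((hu T).toLp (u T)) ((hu T).toLp (u T))) ≤
      gronwallBound (√(B ((hu 0).toLp (u 0)) ((hu 0).toLp (u 0)))) κ β T := by
  have := sqrt_form_le_gronwallBound B hsymm hnn
    (w := fun r : ℝ => (hu r.toNNReal).toLp (u r.toNNReal))
    (w' := fun r : ℝ => (hk r.toNNReal).toLp (k r.toNNReal)) (T := T) (κ := κ) T.coe_nonneg hβ
    (continuous_toLp hu hm hum).continuousOn (fun t ht => by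
      have := hasDerivWithinAt_toLp hu (hk t.toNNReal) t.toNNReal (hder _)
      rwa [Real.coe_toNNReal _ ht.1] at this) (fun t _ => hB _)
  simpa only [Real.toNNReal_coe, Real.toNNReal_zero] using this

end Curves

/-! ### The generator and the invariant measure. -/

section Generator

variable {Ω E : Type*} [MeasurableSpace Ω] [TopologicalSpace E] [MeasurableSpace E]
  {M : MarkovProcess Ω E} {μs : Measure E}

theorem integral_law [IsFiniteMeasure μs] {F : Ω → ℝ} (hF : Measurable F) {K : ℝ}
    (hK : ∀ ω, |F ω| ≤ K) : ∫ ω, F ω ∂(M.law μs) = ∫ x, ∫ ω, F ω ∂(M.P x) ∂μs :=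
  integral_bind_kernel μs M.P hF hK

theorem MarkovProcess.IsInvariant.integral_comp_X (hinv : M.IsInvariant μs) {g : E → ℝ}
    (hg : Measurable g) (t : ℝ≥0) : ∫ ω, g (M.X t ω) ∂(M.law μs) = ∫ x, g x ∂μs := by
  conv_rhs => rw [← hinv t]
  exact (integral_map (M.measurable_X t).aemeasurable hg.aestronglyMeasurable).symm

theorem MarkovProcess.IsInvariant.integral_semigroup [IsFiniteMeasure μs]
    (hinv : M.IsInvariant μs) {g : E → ℝ}
    (hg : Measurable g) {G : ℝ} (hG : ∀ x, |g x| ≤ G) (t : ℝ≥0) :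
    ∫ x, M.semigroup t g x ∂μs = ∫ x, g x ∂μs := by
  rw [← hinv.integral_comp_X hg t]
  exact (integral_law (M := M) (F := fun ω => g (M.X t ω)) (hg.comp (M.measurable_X t))
    (fun _ => hG _)).symm

/-- `Generates` applies the semigroup to a representative of an `L²` class. By invariance a
`μs`-null set is hit at time `t` with probability zero from almost every starting point, so the
choice is immaterial. -/
theorem MarkovProcess.IsInvariant.semigroup_congr_ae (hinv : M.IsInvariant μs) {g k : E → ℝ}
    (h : g =ᵐ[μs] k) (t : ℝ≥0) : M.semigroup t g =ᵐ[μs] M.semigroup t k := by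
  rw [← hinv t] at h
  have h1 := ae_of_ae_map (M.measurable_X t).aemeasurable h
  have h2 := Measure.ae_ae_of_ae_comp h1
  filter_upwards [h2] with x hx using integral_congr_ae hx

theorem MarkovProcess.IsInvariant.generates (hinv : M.IsInvariant μs) {u v : E → ℝ}
    (hu : Measurable u) {G : ℝ} (hG : ∀ x, |u x| ≤ G) (hv : MemLp v 2 μs) (a : ℝ)
    (hua : MemLp (fun x => u x - a) 2 μs)
    (hlim : Tendsto (fun h : ℝ≥0 => eLpNorm (fun x => (M.semigroup h u x - u x) / (h : ℝ) - v x)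
      2 μs) (𝓝[>] 0) (𝓝 0)) :
    M.Generates μs (hua.toLp _) (hv.toLp v) := by
  refine hlim.congr fun h => eLpNorm_congr_ae ?_
  filter_upwards [hua.coeFn_toLp, hv.coeFn_toLp, hinv.semigroup_congr_ae hua.coeFn_toLp h]
    with x h1 h2 h3
  have h4 : M.semigroup h (fun x => u x - a) x = M.semigroup h u x - a := by
    rw [M.semigroup_sub hu hG (measurable_const (a := a)) (G' := |a|) (fun _ => le_rfl)]
    simp [semigroup]
  rw [h3, h4, h1, h2]
  ring

/-- By invariance every difference quotient has mean zero, and the mean is continuous in `L²`. -/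
theorem MarkovProcess.IsInvariant.integral_generator_eq_zero [IsProbabilityMeasure μs]
    (hinv : M.IsInvariant μs)
    {u v : E → ℝ} (hu : Measurable u) {G : ℝ} (hG : ∀ x, |u x| ≤ G) (hv : MemLp v 2 μs)
    (hlim : Tendsto (fun h : ℝ≥0 => eLpNorm (fun x => (M.semigroup h u x - u x) / (h : ℝ) - v x)
      2 μs) (𝓝[>] 0) (𝓝 0)) : ∫ x, v x ∂μs = 0 := by
  have hui : Integrable u μs := .of_bound hu.aestronglyMeasurable G (.of_forall hG)
  have hpi : ∀ h, Integrable (M.semigroup h u) μs := fun h =>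
    .of_bound (M.measurable_semigroup hu h).aestronglyMeasurable G
      (.of_forall (M.abs_semigroup_le hG h))
  have hvi : Integrable v μs := hv.integrable one_le_two
  have h1 : ∀ h : ℝ≥0, ‖∫ x, v x ∂μs‖ₑ ≤
      eLpNorm (fun x => (M.semigroup h u x - u x) / (h : ℝ) - v x) 2 μs := by
    intro h
    have hi : Integrable (fun x => (M.semigroup h u x - u x) / (h : ℝ)) μs :=
      ((hpi h).sub hui).div_const _
    have : ∫ x, ((M.semigroup h u x - u x) / (h : ℝ) - v x) ∂μs = - ∫ x, v x ∂μs := by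
      rw [integral_sub hi hvi, integral_div, integral_sub (hpi h) hui,
        hinv.integral_semigroup hu hG]
      simp
    rw [← enorm_neg, ← this]
    refine (enorm_integral_le_lintegral_enorm _).trans ?_
    rw [← eLpNorm_one_eq_lintegral_enorm]
    exact eLpNorm_le_eLpNorm_of_exponent_le one_le_two (hi.sub hvi).aestronglyMeasurable
  have h2 := ge_of_tendsto hlim (.of_forall h1)
  simpa using h2

end Generator

/-! ### The modified inner product as a bounded form; pairing with the initial density. -/

section Form

variable {E : Type*} [MeasurableSpace E] {μs : Measure E}

/-- An inner product whose norm is dominated by the `L²` norm, as a bounded bilinear form. -/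
theorem exists_continuous_form (ip : InnerProductSpace.Core ℝ (Lp ℝ 2 μs)) {C : ℝ}
    (hup : ∀ g, normSharp ip g ≤ C * ‖g‖) :
    ∃ B : Lp ℝ 2 μs →L[ℝ] Lp ℝ 2 μs →L[ℝ] ℝ, (∀ x y, B x y = ip.inner x y) ∧
      (∀ x y, B x y = B y x) ∧ (∀ x, 0 ≤ B x x) ∧
      ∀ x y, |B x y| ≤ √(B x x) * √(B y y) := by
  have hsymm : ∀ x y, ip.inner y x = ip.inner x y := fun x y => by
    simpa using ip.conj_inner_symm x y
  have hsmul : ∀ (r : ℝ) x y, ip.inner (r • x) y = r * ip.inner x y := fun r x y => by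
    simpa using ip.smul_left x y r
  have hnn : ∀ x, 0 ≤ ip.inner x x := fun x => by simpa using ip.re_inner_nonneg x
  let B₀ : Lp ℝ 2 μs →ₗ[ℝ] Lp ℝ 2 μs →ₗ[ℝ] ℝ := LinearMap.mk₂ ℝ ip.inner ip.add_left
    (fun r x y => hsmul r x y)
    (fun x y z => by rw [← hsymm x, ip.add_left, hsymm x, hsymm x])
    (fun r x y => by rw [← hsymm x, hsmul, hsymm x]; rfl)
  have hcs : ∀ x y, |ip.inner x y| ≤ normSharp ip x * normSharp ip y := fun x y =>
    @InnerProductSpace.Core.norm_inner_le_norm ℝ (Lp ℝ 2 μs) _ _ _ ip.toCore x y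
  have hbd : ∀ x y, ‖B₀ x y‖ ≤ C ^ 2 * ‖x‖ * ‖y‖ := fun x y => by
    refine (hcs x y).trans ?_
    calc normSharp ip x * normSharp ip y ≤ (C * ‖x‖) * (C * ‖y‖) :=
          mul_le_mul (hup x) (hup y) (Real.sqrt_nonneg _) ((Real.sqrt_nonneg _).trans (hup x))
      _ = C ^ 2 * ‖x‖ * ‖y‖ := by ring
  exact ⟨B₀.mkContinuous₂ (C ^ 2) hbd, fun _ _ => rfl, fun x y => hsymm y x, hnn, hcs⟩

variable [IsProbabilityMeasure μs]

theorem const_one_eq_toLp (h : MemLp (fun _ : E => (1 : ℝ)) 2 μs) :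
    Lp.const 2 μs (1 : ℝ) = h.toLp _ := rfl

theorem inner_const_one (g : Lp ℝ 2 μs) : inner ℝ g (Lp.const 2 μs (1 : ℝ)) = ∫ x, g x ∂μs := by
  rw [L2.inner_def]
  refine integral_congr_ae ?_
  filter_upwards [Lp.coeFn_const 2 μs (1 : ℝ)] with x hx
  simp

theorem norm_const_one : ‖(Lp.const 2 μs (1 : ℝ) : Lp ℝ 2 μs)‖ = 1 := by
  simp [Lp.norm_const]

/-- Cauchy–Schwarz in `L²(μs)` against `dμ/dμs`. -/
theorem abs_integral_le_densityNorm_mul {μ : Measure E} [IsProbabilityMeasure μ] (hμ : μ ≪ μs)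
    (hfin : densityNorm μ μs ≠ ∞) {u : E → ℝ} (hu : MemLp u 2 μs) :
    |∫ x, u x ∂μ| ≤ (densityNorm μ μs).toReal * ‖hu.toLp u‖ := by
  have hρ : MemLp (fun x => (μ.rnDeriv μs x).toReal) 2 μs :=
    ⟨(Measure.measurable_rnDeriv μ μs).ennreal_toReal.aestronglyMeasurable, hfin.lt_top⟩
  have h1 : ∫ x, u x ∂μ = inner ℝ (hρ.toLp _) (hu.toLp u) := by
    rw [L2.inner_def, ← integral_rnDeriv_smul hμ]
    refine integral_congr_ae ?_
    filter_upwards [hρ.coeFn_toLp, hu.coeFn_toLp] with x h1 h2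
    rw [h1, h2]
    simp [mul_comm]
  rw [h1, densityNorm, ← Lp.norm_toLp _ hρ]
  exact abs_real_inner_le_norm _ _

end Form

/-! ### Consequences of the modified Poincaré inequality. -/

section Poincare

variable {Ω E : Type*} [MeasurableSpace Ω] [TopologicalSpace E] [MeasurableSpace E]
  {M : MarkovProcess Ω E} {μs : Measure E} [IsProbabilityMeasure μs]

/-- The Poincaré inequality of `ModifiedPoincare` for `u - μs[u]`, where `u` is bounded and
belongs to the domain of the generator. -/
theorem ModifiedPoincare.form_generator {ip : InnerProductSpace.Core ℝ (Lp ℝ 2 μs)}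
    {c C α : ℝ} (hip : ModifiedPoincare M ip c C α) (hinv : M.IsInvariant μs)
    {B : Lp ℝ 2 μs →L[ℝ] Lp ℝ 2 μs →L[ℝ] ℝ} (hB : ∀ x y, B x y = ip.inner x y)
    (hnn : ∀ x, 0 ≤ B x x) {u v : E → ℝ} (hu : Measurable u) {G : ℝ} (hG : ∀ x, |u x| ≤ G)
    (hu2 : MemLp u 2 μs) (hv : MemLp v 2 μs)
    (hlim : Tendsto (fun h : ℝ≥0 => eLpNorm (fun x => (M.semigroup h u x - u x) / (h : ℝ) - v x)
      2 μs) (𝓝[>] 0) (𝓝 0)) :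
    ∃ u₀ : Lp ℝ 2 μs, hu2.toLp u = (∫ x, u x ∂μs) • Lp.const 2 μs (1 : ℝ) + u₀ ∧
      B u₀ (Lp.const 2 μs (1 : ℝ)) = 0 ∧ B (hv.toLp v) (Lp.const 2 μs (1 : ℝ)) = 0 ∧
      B u₀ u₀ ≤ α * B (-hv.toLp v) u₀ := by
  set a := ∫ x, u x ∂μs with ha
  have hua : MemLp (fun x => u x - a) 2 μs := hu2.sub (memLp_const a)
  have hui : Integrable u μs := hu2.integrable one_le_two
  have hmean : ∫ x, hua.toLp _ x ∂μs = 0 := by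
    rw [integral_congr_ae hua.coeFn_toLp, integral_sub hui (integrable_const a)]
    simp [ha]
  refine ⟨hua.toLp _, ?_, ?_, ?_, ?_⟩
  · ext1
    filter_upwards [hu2.coeFn_toLp, hua.coeFn_toLp,
      Lp.coeFn_add (a • Lp.const 2 μs (1 : ℝ)) (hua.toLp _),
      Lp.coeFn_smul a (Lp.const 2 μs (1 : ℝ)), Lp.coeFn_const 2 μs (1 : ℝ)] with x h1 h2 h3 h4 h5
    rw [h1, h3, Pi.add_apply, h4, Pi.smul_apply, h5, h2]
    simp
  · rw [hB, hip.inner_one, inner_const_one, hmean]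
  · rw [hB, hip.inner_one, inner_const_one, integral_congr_ae hv.coeFn_toLp,
      hinv.integral_generator_eq_zero hu hG hv hlim]
  · have := hip.poincare _ _ (hinv.generates hu hG hv a hua hlim) hmean
    rw [normSharp, ← hB, ← hB, Real.sq_sqrt (hnn _)] at this
    exact this

theorem ModifiedPoincare.form_const_one {ip : InnerProductSpace.Core ℝ (Lp ℝ 2 μs)}
    {c C α : ℝ} (hip : ModifiedPoincare M ip c C α) :
    ip.inner (Lp.const 2 μs (1 : ℝ)) (Lp.const 2 μs (1 : ℝ)) = 1 := by
  rw [hip.inner_one, real_inner_self_eq_norm_sq, norm_const_one, one_pow]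

/-- The constant function `1` has norm `1` in both norms. Hence `log c⁻¹ ≥ 0`, which makes `η`
nonnegative. -/
theorem ModifiedPoincare.c_le_one {ip : InnerProductSpace.Core ℝ (Lp ℝ 2 μs)}
    {c C α : ℝ} (hip : ModifiedPoincare M ip c C α) : c ≤ 1 := by
  have := hip.lower (Lp.const 2 μs (1 : ℝ))
  rwa [norm_const_one, mul_one, normSharp, hip.form_const_one, Real.sqrt_one] at this

theorem ModifiedPoincare.log_inv_nonneg {ip : InnerProductSpace.Core ℝ (Lp ℝ 2 μs)}
    {c C α : ℝ} (hip : ModifiedPoincare M ip c C α) :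
    0 ≤ Real.log c⁻¹ :=
  Real.log_nonneg ((one_le_inv₀ hip.c_pos).2 hip.c_le_one)

/-- The numerical range bound defining `bConst`, extended to all of `L²` by homogeneity. -/
theorem ModifiedPoincare.form_le_bConst {ip : InnerProductSpace.Core ℝ (Lp ℝ 2 μs)}
    {c C α : ℝ} (hip : ModifiedPoincare M ip c C α)
    {B : Lp ℝ 2 μs →L[ℝ] Lp ℝ 2 μs →L[ℝ] ℝ} (hB : ∀ x y, B x y = ip.inner x y)
    (hnn : ∀ x, 0 ≤ B x x) (N : Lp ℝ 2 μs →L[ℝ] Lp ℝ 2 μs) (g : Lp ℝ 2 μs) :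
    α * B (N g) g ≤ bConst ip α N * B g g := by
  have hns : ∀ g, normSharp ip g = √(B g g) := fun g => by rw [normSharp, hB]
  set S := {r | ∃ g, normSharp ip g = 1 ∧ r = ip.inner (N g) g} with hS
  have hbdd : BddAbove S := by
    refine ⟨‖B‖ * (‖N‖ * c⁻¹) * c⁻¹, ?_⟩
    rintro _ ⟨g, hg, rfl⟩
    have h1 : ‖g‖ ≤ c⁻¹ := by
      have := hip.lower g
      rw [hg] at this
      rw [← one_div, le_div_iff₀ hip.c_pos]
      linarith
    have hc := hip.c_pos
    rw [← hB]
    refine (le_abs_self _).trans ((B.le_opNorm₂ (N g) g).trans ?_)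
    have h2 : ‖N g‖ ≤ ‖N‖ * c⁻¹ := (N.le_opNorm g).trans (by gcongr)
    gcongr
  rcases (hnn g).eq_or_lt with h0 | h0
  · have hg : g = 0 := ip.definite g (by rw [← hB, ← h0])
    simp [hg]
  · set r := √(B g g) with hr
    have hr0 : 0 < r := Real.sqrt_pos.2 h0
    have hr2 : r * r = B g g := Real.mul_self_sqrt h0.le
    have hmem : B (N (r⁻¹ • g)) (r⁻¹ • g) ∈ S := by
      refine ⟨r⁻¹ • g, ?_, hB _ _⟩
      rw [hns, Real.sqrt_eq_one]
      simp only [map_smul, _root_.smul_apply, smul_eq_mul, ← hr2]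
      field_simp
    have h1 := (le_csSup hbdd hmem).trans (le_max_right 0 _)
    have h2 : B (N (r⁻¹ • g)) (r⁻¹ • g) = B (N g) g / B g g := by
      simp only [map_smul, _root_.smul_apply, smul_eq_mul, ← hr2]
      field_simp
    rw [h2, div_le_iff₀ h0] at h1
    rw [bConst, mul_assoc]
    exact mul_le_mul_of_nonneg_left h1 hip.alpha_pos.le

theorem ModifiedPoincare.norm_le_form {ip : InnerProductSpace.Core ℝ (Lp ℝ 2 μs)}
    {c C α : ℝ} (hip : ModifiedPoincare M ip c C α)
    {B : Lp ℝ 2 μs →L[ℝ] Lp ℝ 2 μs →L[ℝ] ℝ} (hB : ∀ x y, B x y = ip.inner x y)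
    (g : Lp ℝ 2 μs) : ‖g‖ ≤ c⁻¹ * √(B g g) := by
  have := hip.lower g
  rw [normSharp, ← hB] at this
  rw [inv_mul_eq_div, le_div_iff₀ hip.c_pos]
  linarith

end Poincare

/-! ### The constants `v` and `b`. -/

section Constants

variable {E : Type*} [MeasurableSpace E] {μs : Measure E}
  {ip : InnerProductSpace.Core ℝ (Lp ℝ 2 μs)} {α : ℝ}

theorem memLp_two_of_bound [IsFiniteMeasure μs] {u : E → ℝ} (hu : Measurable u) {G : ℝ} (hG : ∀ x, |u x| ≤ G) :
    MemLp u 2 μs :=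
  .of_bound hu.aestronglyMeasurable G (.of_forall hG)

theorem vConst_eq [IsFiniteMeasure μs] {B : Lp ℝ 2 μs →L[ℝ] Lp ℝ 2 μs →L[ℝ] ℝ} (hB : ∀ x y, B x y = ip.inner x y)
    (hnn : ∀ x, 0 ≤ B x x) (N : Lp ℝ 2 μs →L[ℝ] Lp ℝ 2 μs) :
    vConst ip α N = 2 * α * B ((1 / 2 : ℝ) • (N (Lp.const 2 μs (1 : ℝ)) +
      adjoint ip N (Lp.const 2 μs (1 : ℝ)))) ((1 / 2 : ℝ) • (N (Lp.const 2 μs (1 : ℝ)) +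
      adjoint ip N (Lp.const 2 μs (1 : ℝ)))) := by
  rw [vConst, normSharp, ← hB, Real.sq_sqrt (hnn _)]

theorem vConst_nonneg [IsFiniteMeasure μs] (hα : 0 < α) (N : Lp ℝ 2 μs →L[ℝ] Lp ℝ 2 μs) : 0 ≤ vConst ip α N := by
  rw [vConst]
  positivity

theorem bConst_nonneg (hα : 0 < α) (N : Lp ℝ 2 μs →L[ℝ] Lp ℝ 2 μs) : 0 ≤ bConst ip α N :=
  mul_nonneg hα.le (le_max_left _ _)

end Constants

/-! ### Exponential moments and bias under the Markov process. -/

section Bounds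

variable {Ω E : Type*} [MeasurableSpace Ω] [TopologicalSpace E] [PolishSpace E]
  [MeasurableSpace E] [BorelSpace E] {M : MarkovProcess Ω E} {μs : Measure E}
  [IsProbabilityMeasure μs] {ip : InnerProductSpace.Core ℝ (Lp ℝ 2 μs)} {c C α : ℝ}

/-- The bound on the numerical range of `A + l M_φ`. -/
theorem ModifiedPoincare.form_feynmanKac_le (hip : ModifiedPoincare M ip c C α)
    (hinv : M.IsInvariant μs) {B : Lp ℝ 2 μs →L[ℝ] Lp ℝ 2 μs →L[ℝ] ℝ}
    (hB : ∀ x y, B x y = ip.inner x y) (hsymm : ∀ x y, B x y = B y x) (hnn : ∀ x, 0 ≤ B x x)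
    {φ : E → ℝ} (hφ : MemLp φ ∞ μs) (hφ0 : ∫ x, φ x ∂μs = 0) {l : ℝ} (hl : 0 < l)
    (hlb : l * bConst ip α (mulOp φ hφ) < 1) {u k : E → ℝ} (hu : Measurable u) {G : ℝ}
    (hG : ∀ x, |u x| ≤ G) (hu2 : MemLp u 2 μs) (hk : MemLp k 2 μs)
    (hlim : Tendsto (fun h : ℝ≥0 => eLpNorm (fun x => (M.semigroup h u x - u x) / (h : ℝ)
      - (k x - (l * φ x) * u x)) 2 μs) (𝓝[>] 0) (𝓝 0)) :
    B (hk.toLp k) (hu2.toLp u) ≤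
      l ^ 2 * vConst ip α (mulOp φ hφ) / (2 * (1 - l * bConst ip α (mulOp φ hφ))) *
        B (hu2.toLp u) (hu2.toLp u) := by
  set N := mulOp φ hφ with hN
  have hNu : N (hu2.toLp u) =ᵐ[μs] fun x => φ x * u x := by
    filter_upwards [coeFn_mulOp φ hφ (hu2.toLp u), hu2.coeFn_toLp] with x h1 h2
    rw [h1, h2]
  have hφu : MemLp (fun x => (l * φ x) * u x) 2 μs := by
    refine ((memLp_congr_ae hNu).1 (Lp.memLp _)).const_mul l |>.ae_eq (.of_forall fun x => ?_)
    ring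
  have hv : MemLp (fun x => k x - (l * φ x) * u x) 2 μs := hk.sub hφu
  obtain ⟨u₀, hu₀, h1, h2, h3⟩ := hip.form_generator hinv hB hnn hu hG hu2 hv hlim
  -- The time derivative `k` is written as `A u + l M_φ u`, with `A u` supplied by `hlim`.
  have hsum : hk.toLp k = hv.toLp _ + l • N (hu2.toLp u) := by
    ext1
    filter_upwards [hk.coeFn_toLp, hv.coeFn_toLp, hNu,
      Lp.coeFn_add (hv.toLp _) (l • N (hu2.toLp u)), Lp.coeFn_smul l (N (hu2.toLp u))]
      with x e1 e2 e3 e4 e5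
    rw [e1, e4, Pi.add_apply, e5, Pi.smul_apply, e3, e2, smul_eq_mul]
    ring
  rw [hsum, vConst_eq hB hnn]
  have := form_perturbation_le (B.toLinearMap₁₂) hsymm hnn N.toLinearMap
    (e := Lp.const 2 μs (1 : ℝ)) (e' := adjoint ip N (Lp.const 2 μs (1 : ℝ))) (u₀ := u₀)
    (h := hv.toLp _) (a := ∫ x, u x ∂μs) (b := bConst ip α N)
    ((hB _ _).trans hip.form_const_one) h1 h2 hip.alpha_pos h3 ?_ ?_
    (hip.form_le_bConst hB hnn N) hl hlb
  · rw [hu₀]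
    exact this
  -- `⟨M_φ 1, 1⟩_#` is the mean of `φ`, so centering removes the `a²` term.
  · refine (hB _ _).trans ?_
    change ip.inner (N (Lp.const 2 μs (1 : ℝ))) _ = 0
    rw [hip.inner_one, inner_const_one, ← hφ0]
    refine integral_congr_ae ?_
    filter_upwards [coeFn_mulOp φ hφ (Lp.const 2 μs (1 : ℝ)), Lp.coeFn_const 2 μs (1 : ℝ)]
      with x e1 e2
    rw [e1, e2]
    simp
  · intro g
    refine (hB _ _).trans ?_
    refine (adjoint_spec ip hip.c_pos hip.lower hip.upper N g _).trans (hB _ _).symm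

/-- The bound on exponential moments of additive functionals. -/
theorem ModifiedPoincare.integral_exp_occupation_le (hip : ModifiedPoincare M ip c C α)
    (hinv : M.IsInvariant μs) {φ : E → ℝ} (hφm : Measurable φ) {K : ℝ} (hφK : ∀ x, |φ x| ≤ K)
    (hφ : MemLp φ ∞ μs) (hφ0 : ∫ x, φ x ∂μs = 0) {l : ℝ} (hl : 0 < l)
    (hlb : l * bConst ip α (mulOp φ hφ) < 1) {μ : Measure E} [IsProbabilityMeasure μ]
    (hμ : μ ≪ μs) (hfin : densityNorm μ μs ≠ ∞) (T : ℝ≥0) :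
    ∫ ω, Real.exp (occupation (fun x => l * φ x) M.X T ω) ∂(M.law μ) ≤
      (densityNorm μ μs).toReal * (c⁻¹ * Real.exp (l ^ 2 * vConst ip α (mulOp φ hφ) /
        (2 * (1 - l * bConst ip α (mulOp φ hφ))) * T)) := by
  obtain ⟨B, hB, hsymm, hnn, -⟩ := exists_continuous_form ip hip.upper
  set V : E → ℝ := fun x => l * φ x with hVdef
  have hV : Measurable V := hφm.const_mul l
  have hVK : ∀ x, |V x| ≤ l * K := fun x => by
    rw [hVdef, abs_mul, abs_of_pos hl]
    exact mul_le_mul_of_nonneg_left (hφK x) hl.le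
  have hone : ∀ x : E, |(fun _ => (1 : ℝ)) x| ≤ 1 := by simp
  have hum := fun t => M.measurable_feynmanKac hV (measurable_const (a := (1 : ℝ))) t
  have hub := fun t => M.abs_feynmanKac_le hVK hone t
  have hu2 : ∀ t, MemLp (M.feynmanKac V t fun _ => 1) 2 μs := fun t =>
    memLp_two_of_bound (hum t) (hub t)
  have hk2 : ∀ t, MemLp (M.feynmanKac V t V) 2 μs := fun t =>
    memLp_two_of_bound (M.measurable_feynmanKac hV hV t) (M.abs_feynmanKac_le hVK hVK t)
  -- The numerical range bound along the curve is the rate `κ`; without forcing this gives `‖u_T‖_#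
  -- ≤ e^{κT}` from `‖1‖_# = 1`.
  have hgron := sqrt_form_toLp_le_gronwallBound B hsymm hnn hu2 hk2
    (m := fun t : ℝ≥0 => Real.exp (l * K * t)) (by fun_prop)
    (M.abs_feynmanKac_one_sub_le hV hVK) (hinv.tendsto_feynmanKac_one_slope hV hVK)
    (κ := l ^ 2 * vConst ip α (mulOp φ hφ) / (2 * (1 - l * bConst ip α (mulOp φ hφ))))
    (β := 0) le_rfl (fun t => by
      rw [zero_mul, add_zero]
      exact hip.form_feynmanKac_le hinv hB hsymm hnn hφ hφ0 hl hlb (hum t) (hub t) (hu2 t)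
        (hk2 t) (hinv.tendsto_semigroup_feynmanKac_one hV hVK t)) T
  have h0 : (hu2 0).toLp _ = Lp.const 2 μs (1 : ℝ) := by
    rw [const_one_eq_toLp (memLp_const 1)]
    refine MemLp.toLp_congr _ _ (.of_forall fun x => ?_)
    simp [MarkovProcess.feynmanKac, occupation]
  rw [h0, hB _ (Lp.const 2 μs (1 : ℝ)), hip.form_const_one, Real.sqrt_one, gronwallBound_ε0,
    one_mul] at hgron
  have hlaw : ∫ ω, Real.exp (occupation V M.X T ω) ∂(M.law μ) =
      ∫ x, M.feynmanKac V T (fun _ => 1) x ∂μ := by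
    rw [integral_law (M.measurable_occupation hV T).exp (K := Real.exp (l * K * T)) (fun ω => by
      rw [Real.abs_exp]
      exact exp_occupation_le hVK _ _ _)]
    simp [MarkovProcess.feynmanKac]
  rw [hlaw]
  refine (le_abs_self _).trans ((abs_integral_le_densityNorm_mul hμ hfin (hu2 T)).trans ?_)
  refine mul_le_mul_of_nonneg_left ((hip.norm_le_form hB _).trans ?_) ENNReal.toReal_nonneg
  exact mul_le_mul_of_nonneg_left hgron (inv_nonneg.2 hip.c_pos.le)

/-- Fubini and invariance. The bias curve thus has no constant component, and the Poincaré
inequality controls all of it. -/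
theorem integral_meanOccupation_eq_zero (hinv : M.IsInvariant μs) {φ : E → ℝ}
    (hφm : Measurable φ) {K : ℝ} (hφK : ∀ x, |φ x| ≤ K) (hφ0 : ∫ x, φ x ∂μs = 0) (t : ℝ≥0) :
    ∫ x, M.meanOccupation φ t x ∂μs = 0 := by
  have h1 := integral_law (M := M) (μs := μs) (M.measurable_occupation hφm t)
    (abs_occupation_le hφK M.X t)
  unfold MarkovProcess.meanOccupation
  rw [← h1]
  have hjoint : Measurable (fun p : Ω × ℝ => φ (M.X p.2.toNNReal p.1)) :=
    hφm.comp (M.measurable_uncurry_X.comp (measurable_snd.real_toNNReal.prodMk measurable_fst))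
  simp only [occupation, intervalIntegral.integral_of_le t.coe_nonneg]
  rw [integral_integral_swap]
  · simp [hinv.integral_comp_X hφm, hφ0]
  · exact .of_bound hjoint.aestronglyMeasurable K (.of_forall fun p => hφK _)

/-- The bound on the bias of time averages started from `μ` instead of the invariant measure. -/
theorem ModifiedPoincare.abs_integral_occupation_le (hip : ModifiedPoincare M ip c C α)
    (hinv : M.IsInvariant μs) {φ : E → ℝ} (hφm : Measurable φ) {K : ℝ} (hφK : ∀ x, |φ x| ≤ K)
    (hφ2 : MemLp φ 2 μs) (hφ0 : ∫ x, φ x ∂μs = 0) {μ : Measure E} [IsProbabilityMeasure μ]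
    (hμ : μ ≪ μs) (hfin : densityNorm μ μs ≠ ∞) (T : ℝ≥0) :
    |∫ ω, occupation φ M.X T ω ∂(M.law μ)| ≤ (densityNorm μ μs).toReal *
      (c⁻¹ * (C * ‖hφ2.toLp φ‖ * (α * (1 - Real.exp (-(T : ℝ) / α))))) := by
  obtain ⟨B, hB, hsymm, hnn, hcs⟩ := exists_continuous_form ip hip.upper
  have hα := hip.alpha_pos
  have hum := fun t => M.measurable_meanOccupation hφm t
  have hub := fun t => M.abs_meanOccupation_le hφK t
  have hu2 : ∀ t, MemLp (M.meanOccupation φ t) 2 μs := fun t =>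
    memLp_two_of_bound (hum t) (hub t)
  have hk2 : ∀ t, MemLp (M.semigroup t φ) 2 μs := fun t =>
    memLp_two_of_bound (M.measurable_semigroup hφm t) (M.abs_semigroup_le hφK t)
  -- Since `P_t φ = A u_t + φ`, the Poincaré inequality yields the decay rate `1/α`, and
  -- Cauchy–Schwarz for `⟨φ, u_t⟩_#` the forcing `‖φ‖_#`.
  have hgron := sqrt_form_toLp_le_gronwallBound B hsymm hnn hu2 hk2
    (m := fun t : ℝ≥0 => K * t) (by fun_prop)
    (M.abs_meanOccupation_sub_le hφm hφK) (hinv.tendsto_meanOccupation_slope hφm hφK)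
    (κ := -α⁻¹) (β := √(B (hφ2.toLp φ) (hφ2.toLp φ))) (Real.sqrt_nonneg _) (fun t => by
      obtain ⟨u₀, hu₀, h1, h2, h3⟩ := hip.form_generator hinv hB hnn (hum t) (hub t) (hu2 t)
        ((hk2 t).sub hφ2) (hinv.tendsto_semigroup_meanOccupation hφm hφK t)
      rw [integral_meanOccupation_eq_zero hinv hφm hφK hφ0, zero_smul, zero_add] at hu₀
      rw [MemLp.toLp_sub, ← hu₀] at h3
      have h4 := (le_abs_self _).trans (hcs (hφ2.toLp φ) ((hu2 t).toLp _))
      simp only [neg_sub, map_sub, _root_.sub_apply] at h3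
      have h5 : α⁻¹ * B ((hu2 t).toLp _) ((hu2 t).toLp _) ≤
          B (hφ2.toLp φ) ((hu2 t).toLp _) - B ((hk2 t).toLp _) ((hu2 t).toLp _) := by
        rw [inv_mul_le_iff₀ hα]
        exact h3
      linarith) T
  have h0 : (hu2 0).toLp _ = 0 := by
    rw [← MemLp.toLp_zero (memLp_const (0 : ℝ))]
    refine MemLp.toLp_congr _ _ (.of_forall fun x => ?_)
    simp [MarkovProcess.meanOccupation, occupation]
  rw [h0, map_zero, Real.sqrt_zero,
    gronwallBound_of_K_ne_0 (neg_ne_zero.2 (inv_ne_zero hα.ne'))] at hgron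
  simp only [zero_mul, zero_add] at hgron
  have hlaw : ∫ ω, occupation φ M.X T ω ∂(M.law μ) = ∫ x, M.meanOccupation φ T x ∂μ :=
    integral_law (M.measurable_occupation hφm T) (abs_occupation_le hφK M.X T)
  rw [hlaw]
  refine (abs_integral_le_densityNorm_mul hμ hfin (hu2 T)).trans ?_
  refine mul_le_mul_of_nonneg_left ((hip.norm_le_form hB _).trans ?_) ENNReal.toReal_nonneg
  refine mul_le_mul_of_nonneg_left (hgron.trans ?_) (inv_nonneg.2 hip.c_pos.le)
  have hup : √(B (hφ2.toLp φ) (hφ2.toLp φ)) ≤ C * ‖hφ2.toLp φ‖ := by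
    rw [hB]
    exact hip.upper _
  have hexp : 0 ≤ α * (1 - Real.exp (-(T : ℝ) / α)) := by
    refine mul_nonneg hα.le (sub_nonneg.2 (Real.exp_le_one_iff.2 ?_))
    exact div_nonpos_of_nonpos_of_nonneg (neg_nonpos.2 T.coe_nonneg) hα.le
  calc √(B (hφ2.toLp φ) (hφ2.toLp φ)) / -α⁻¹ * (Real.exp (-α⁻¹ * T) - 1)
      = √(B (hφ2.toLp φ) (hφ2.toLp φ)) * (α * (1 - Real.exp (-(T : ℝ) / α))) := by
        rw [show -α⁻¹ * (T : ℝ) = -(T : ℝ) / α by field_simp]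
        field_simp
        ring
    _ ≤ _ := mul_le_mul_of_nonneg_right hup hexp

end Bounds

/-! ### Centered observables, time averages and the density norm. -/

theorem abs_timeAverage_le {Ω E : Type*} {f : E → ℝ} {K : ℝ} (hK : ∀ x, |f x| ≤ K) {X : ℝ≥0 → Ω → E}
    {T : ℝ≥0} (hT : 0 < T) (ω : Ω) : |timeAverage X f T ω| ≤ K := by
  have h := abs_occupation_le hK X T ω
  have hT' : (0 : ℝ) < T := hT
  rw [timeAverage, abs_mul, abs_of_pos (by positivity), one_div, inv_mul_le_iff₀ hT', mul_comm]
  exact h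

section Centered

variable {E : Type*} [MeasurableSpace E] {μs : Measure E} {f : E → ℝ} {K : ℝ}

theorem measurable_centered (hf : Measurable f) (s : ℝ) : Measurable (centered μs f s) :=
  (hf.sub_const _).const_mul s

theorem abs_centered_le (hK : ∀ x, |f x| ≤ K) (s : ℝ) (x : E) :
    |centered μs f s x| ≤ |s| * (K + |∫ y, f y ∂μs|) := by
  rw [centered, abs_mul]
  exact mul_le_mul_of_nonneg_left ((abs_sub _ _).trans (add_le_add_left (hK x) _)) (abs_nonneg s)

theorem integral_centered [IsProbabilityMeasure μs] (hf : Measurable f) (hK : ∀ x, |f x| ≤ K) (s : ℝ) :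
    ∫ x, centered μs f s x ∂μs = 0 := by
  have hi : Integrable f μs := .of_bound hf.aestronglyMeasurable K (.of_forall hK)
  simp only [centered]
  rw [integral_const_mul, integral_sub hi (integrable_const _)]
  simp

theorem norm_toLp_centered (hf : Measurable f) {s : ℝ}
    (hs : s = 1 ∨ s = -1) (h2 : MemLp (centered μs f s) 2 μs) :
    ‖h2.toLp (centered μs f s)‖ = √(Var[f; μs]) := by
  have hs2 : s ^ 2 = 1 := by rcases hs with rfl | rfl <;> norm_num
  have h : ‖h2.toLp (centered μs f s)‖ ^ 2 = Var[f; μs] := by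
    rw [variance_eq_integral hf.aemeasurable, ← real_inner_self_eq_norm_sq, L2.inner_def]
    refine integral_congr_ae ?_
    filter_upwards [h2.coeFn_toLp] with x hx
    rw [hx]
    simp only [centered, RCLike.inner_apply, conj_trivial]
    linear_combination ((f x - ∫ y, f y ∂μs) ^ 2) * hs2
  rw [← h, Real.sqrt_sq (norm_nonneg _)]

theorem occupation_centered {Ω : Type*} [MeasurableSpace Ω] [TopologicalSpace E] [PolishSpace E]
    [BorelSpace E] {X : ℝ≥0 → Ω → E} (hm : ∀ t, Measurable (X t))
    (hr : ∀ ω, IsCadlag fun t => X t ω) (hf : Measurable f) (hK : ∀ x, |f x| ≤ K) (s : ℝ)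
    {T : ℝ≥0} (hT : 0 < T) (ω : Ω) :
    occupation (centered μs f s) X T ω =
      T * (s * (timeAverage X f T ω - ∫ x, f x ∂μs)) := by
  have hT' : (T : ℝ) ≠ 0 := NNReal.coe_ne_zero.2 hT.ne'
  have hi := intervalIntegrable_comp hm (fun ω t => (hr ω t).1) hf hK ω 0 T
  simp only [occupation, centered, timeAverage]
  rw [intervalIntegral.integral_const_mul, intervalIntegral.integral_sub hi (by simp)]
  simp
  field_simp

theorem measurable_timeAverage {Ω : Type*} [MeasurableSpace Ω] [TopologicalSpace E] [PolishSpace E]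
    [BorelSpace E] {X : ℝ≥0 → Ω → E} (hm : ∀ t, Measurable (X t))
    (hr : ∀ ω, IsCadlag fun t => X t ω) (hf : Measurable f) (T : ℝ≥0) :
    Measurable (timeAverage X f T) :=
  (measurable_occupation hm (fun ω t => (hr ω t).1) hf T).const_mul _

theorem integral_occupation_centered {Ω : Type*} [MeasurableSpace Ω] [TopologicalSpace E]
    [PolishSpace E] [BorelSpace E] {X : ℝ≥0 → Ω → E} (hm : ∀ t, Measurable (X t))
    (hr : ∀ ω, IsCadlag fun t => X t ω) (hf : Measurable f) (hK : ∀ x, |f x| ≤ K) (s : ℝ)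
    {T : ℝ≥0} (hT : 0 < T) (P : Measure Ω) [IsProbabilityMeasure P] :
    ∫ ω, occupation (centered μs f s) X T ω ∂P =
      T * (s * ((∫ ω, timeAverage X f T ω ∂P) - ∫ x, f x ∂μs)) := by
  have hi : Integrable (timeAverage X f T) P :=
    .of_bound (measurable_timeAverage hm hr hf T).aestronglyMeasurable K
      (.of_forall (abs_timeAverage_le hK hT))
  simp_rw [occupation_centered hm hr hf hK s hT]
  rw [integral_const_mul, integral_const_mul, integral_sub hi (integrable_const _)]
  simp

theorem one_le_toReal_densityNorm [IsProbabilityMeasure μs] {μ : Measure E} [IsProbabilityMeasure μ] (hμ : μ ≪ μs)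
    (hfin : densityNorm μ μs ≠ ∞) : 1 ≤ (densityNorm μ μs).toReal := by
  have h := abs_integral_le_densityNorm_mul hμ hfin (memLp_const (1 : ℝ))
  rw [← const_one_eq_toLp, norm_const_one] at h
  simpa using h

theorem densityNorm_self [IsProbabilityMeasure μs] : densityNorm μs μs = 1 := by
  have : (fun x => (μs.rnDeriv μs x).toReal) =ᵐ[μs] fun _ => (1 : ℝ) := by
    filter_upwards [μs.rnDeriv_self] with x hx
    simp [hx]
  rw [densityNorm, eLpNorm_congr_ae this, eLpNorm_const _ (by simp) (NeZero.ne μs)]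
  simp

end Centered

/-! ### The two halves of the fixed-time bound. -/

section Main

variable {Ω E : Type*} [MeasurableSpace Ω] [TopologicalSpace E] [PolishSpace E]
  [MeasurableSpace E] [BorelSpace E] {M : MarkovProcess Ω E} {μs : Measure E}
  [IsProbabilityMeasure μs] {ip : InnerProductSpace.Core ℝ (Lp ℝ 2 μs)} {c C α : ℝ}

/-- Donsker–Varadhan on path space for `l ∫₀ᵀ φ(x_r) dr`, the logarithm of the exponential moment
bound, and division by `l T`. The parameter `l` stays free so that the limit `T → ∞` can precede the
optimisation. -/
theorem ModifiedPoincare.timeAverage_sub_le (hip : ModifiedPoincare M ip c C α)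
    (hinv : M.IsInvariant μs) {Ω' : Type*} [MeasurableSpace Ω'] (P' : Measure Ω')
    [IsProbabilityMeasure P'] (X' : ℝ≥0 → Ω' → E) (hX'm : ∀ t, Measurable (X' t))
    (hX' : ∀ ω, IsCadlag (fun t => X' t ω)) {f : E → ℝ} (hf : Measurable f)
    (hfb : ∃ K, ∀ x, |f x| ≤ K) (s : ℝ) {μ : Measure E} [IsProbabilityMeasure μ]
    (hμ : μ ≪ μs) (hfin : densityNorm μ μs ≠ ∞) {T : ℝ≥0} (hT : 0 < T)
    (hkl : InformationTheory.klDiv (pathLaw P' X' hX' T)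
      (pathLaw (M.law μ) M.X M.cadlag T) ≠ ∞) {l : ℝ} (hl : 0 < l)
    (hlb : l * bConst ip α (mulOp (centered μs f s) (memLp_centered hf hfb s)) < 1) :
    s * ((∫ ω, timeAverage X' f T ω ∂P') - ∫ x, f x ∂μs) ≤
      l * vConst ip α (mulOp (centered μs f s) (memLp_centered hf hfb s)) /
        (2 * (1 - l * bConst ip α (mulOp (centered μs f s) (memLp_centered hf hfb s)))) +
      (1 / (T : ℝ)) * (Real.log c⁻¹ + Real.log (densityNorm μ μs).toReal +
        (InformationTheory.klDiv (pathLaw P' X' hX' T)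
          (pathLaw (M.law μ) M.X M.cadlag T)).toReal) / l := by
  obtain ⟨K, hK⟩ := hfb
  have hφm : Measurable (centered μs f s) := measurable_centered hf s
  have hφK : ∀ x, |centered μs f s x| ≤ |s| * (K + |∫ y, f y ∂μs|) := abs_centered_le hK s
  set L := |s| * (K + |∫ y, f y ∂μs|)
  have hT' : (0 : ℝ) < T := hT
  have hVm : Measurable fun x => l * centered μs f s x := hφm.const_mul l
  have hVK : ∀ x, |l * centered μs f s x| ≤ l * L := fun x => by
    rw [abs_mul, abs_of_pos hl]
    exact mul_le_mul_of_nonneg_left (hφK x) hl.le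
  have hm' := measurable_pathMap X' hX' hX'm T
  have hm := measurable_pathMap M.X M.cadlag M.measurable_X T
  have hp1 : IsProbabilityMeasure (pathLaw P' X' hX' T) :=
    Measure.isProbabilityMeasure_map hm'.aemeasurable
  have hp2 : IsProbabilityMeasure (pathLaw (M.law μ) M.X M.cadlag T) :=
    Measure.isProbabilityMeasure_map hm.aemeasurable
  have hF := measurable_pathOccupation hVm T
  have hDV := integral_le_klDiv_add_log _ _ hkl hF (abs_pathOccupation_le hVK)
  rw [pathLaw, pathLaw, integral_map hm'.aemeasurable hF.aestronglyMeasurable,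
    integral_map hm.aemeasurable hF.exp.aestronglyMeasurable, ← pathLaw, ← pathLaw] at hDV
  simp_rw [pathOccupation_pathMap] at hDV
  have hocc : ∀ ω, occupation (fun x => l * centered μs f s x) X' T ω = l * occupation (centered μs f s) X' T ω := fun ω =>
    intervalIntegral.integral_const_mul _ _
  simp_rw [hocc] at hDV
  rw [integral_const_mul, integral_occupation_centered hX'm hX' hf hK s hT] at hDV
  have hmgf := hip.integral_exp_occupation_le hinv hφm hφK (memLp_centered hf ⟨K, hK⟩ s)
    (integral_centered hf hK s) hl hlb hμ hfin T
  have hpos : 0 < ∫ ω, Real.exp (occupation (fun x => l * centered μs f s x) M.X T ω) ∂(M.law μ) := by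
    refine integral_exp_pos (.of_bound
      (M.measurable_occupation hVm T).exp.aestronglyMeasurable (Real.exp (l * L * T))
      (.of_forall fun ω => ?_))
    rw [Real.norm_eq_abs, Real.abs_exp]
    exact exp_occupation_le hVK _ _ _
  have hD := one_le_toReal_densityNorm hμ hfin
  have hlog := Real.log_le_log hpos hmgf
  rw [Real.log_mul (by linarith) (mul_pos (inv_pos.2 hip.c_pos) (Real.exp_pos _)).ne',
    Real.log_mul (inv_pos.2 hip.c_pos).ne' (Real.exp_pos _).ne', Real.log_exp] at hlog
  have hd := sub_pos.2 hlb
  have hfinal := hDV.trans (add_le_add_right hlog _)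
  have hscale := div_le_div_of_nonneg_right hfinal (mul_pos hl hT').le
  refine le_of_eq_of_le ?_ (hscale.trans_eq ?_)
  · field_simp
  · field_simp
    ring

/-- The bias curve estimate divided by `T`: `α (1 - e^{-T/α}) / T` is the stated time factor, and
`‖φ‖` is the standard deviation of `f` under `μs`. -/
theorem ModifiedPoincare.bias_le (hip : ModifiedPoincare M ip c C α)
    (hinv : M.IsInvariant μs) {f : E → ℝ} (hf : Measurable f)
    (hfb : ∃ K, ∀ x, |f x| ≤ K) {s : ℝ} (hs : s = 1 ∨ s = -1) {μ : Measure E}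
    [IsProbabilityMeasure μ] (hμ : μ ≪ μs) (hfin : densityNorm μ μs ≠ ∞) {T : ℝ≥0} (hT : 0 < T) :
    s * ((∫ x, f x ∂μs) - ∫ ω, timeAverage M.X f T ω ∂(M.law μ)) ≤
      C / c * ((1 - Real.exp (-(T : ℝ) / α)) / ((T : ℝ) / α))
        * (densityNorm μ μs).toReal * √(Var[f; μs]) := by
  obtain ⟨K, hK⟩ := hfb
  have hT' : (0 : ℝ) < T := hT
  have hα := hip.alpha_pos
  have hc := hip.c_pos
  have h2 : MemLp (centered μs f s) 2 μs :=
    memLp_two_of_bound (measurable_centered hf s) (abs_centered_le hK s)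
  have h := hip.abs_integral_occupation_le hinv (measurable_centered hf s) (abs_centered_le hK s)
    h2 (integral_centered hf hK s) hμ hfin T
  rw [norm_toLp_centered hf hs, integral_occupation_centered M.measurable_X M.cadlag hf hK s hT]
    at h
  have h3 := (neg_le_abs _).trans h
  have h4 := div_le_div_of_nonneg_right h3 hT'.le
  refine le_of_eq_of_le ?_ (h4.trans_eq ?_)
  · field_simp
    ring
  · field_simp

end Main

end HypoUQ

/-! ### Assembly of the fixed-time and the asymptotic bounds. -/

theorem theorem3p4 {Ω E : Type*} [MeasurableSpace Ω]
    [TopologicalSpace E] [PolishSpace E] [MeasurableSpace E] [BorelSpace E]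
    (M : HypoUQ.MarkovProcess Ω E)
    (μs : Measure E) [IsProbabilityMeasure μs] (hμs : M.IsErgodicMeasure μs)
    (ip : InnerProductSpace.Core ℝ (Lp ℝ 2 μs)) (c C α : ℝ)
    (hip : HypoUQ.ModifiedPoincare M ip c C α)
    {Ω' : Type*} [MeasurableSpace Ω'] (P' : Measure Ω') [IsProbabilityMeasure P']
    (X' : ℝ≥0 → Ω' → E) (hX'm : ∀ t, Measurable (X' t))
    (hX' : ∀ ω, HypoUQ.IsCadlag (fun t => X' t ω))
    (f : E → ℝ) (hf : Measurable f) (hfb : ∃ K, ∀ x, |f x| ≤ K)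
    (s : ℝ) (hs : s = 1 ∨ s = -1) (v b : ℝ)
    (hv : v = HypoUQ.vConst ip α
      (HypoUQ.mulOp (HypoUQ.centered μs f s) (HypoUQ.memLp_centered hf hfb s)))
    (hb : b = HypoUQ.bConst ip α
      (HypoUQ.mulOp (HypoUQ.centered μs f s) (HypoUQ.memLp_centered hf hfb s))) :
    (∀ (μ : Measure E) [IsProbabilityMeasure μ], μ ≪ μs → HypoUQ.densityNorm μ μs ≠ ∞ →
      ∀ T : ℝ≥0, 0 < T →
      InformationTheory.klDiv (HypoUQ.pathLaw P' X' hX' T)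
        (HypoUQ.pathLaw (M.law μ) M.X M.cadlag T) ≠ ∞ →
      ∀ η : ℝ, η = (1 / (T : ℝ)) * (Real.log c⁻¹ + Real.log (HypoUQ.densityNorm μ μs).toReal
        + (InformationTheory.klDiv (HypoUQ.pathLaw P' X' hX' T)
            (HypoUQ.pathLaw (M.law μ) M.X M.cadlag T)).toReal) →
      s * ((∫ ω, HypoUQ.timeAverage X' f T ω ∂P')
          - ∫ ω, HypoUQ.timeAverage M.X f T ω ∂(M.law μ))
        ≤ √(2 * v * η) + b * η
          + C / c * ((1 - Real.exp (-(T : ℝ) / α)) / ((T : ℝ) / α))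
            * (HypoUQ.densityNorm μ μs).toReal * √(Var[f; μs])) ∧
    (∀ (ν : Measure E) [IsProbabilityMeasure ν], HypoUQ.IsErgodicProcess P' X' ν →
      ∀ η : ℝ≥0,
      Tendsto (fun T : ℝ≥0 => InformationTheory.klDiv (HypoUQ.pathLaw P' X' hX' T)
        (HypoUQ.pathLaw (M.law μs) M.X M.cadlag T) / (T : ℝ≥0∞)) atTop (𝓝 (η : ℝ≥0∞)) →
      s * ((∫ x, f x ∂ν) - ∫ x, f x ∂μs) ≤ √(2 * v * η) + b * η) := by
  have hinv := hμs.1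
  have hα := hip.alpha_pos
  have hv0 : 0 ≤ v := hv ▸ HypoUQ.vConst_nonneg hα _
  have hb0 : 0 ≤ b := hb ▸ HypoUQ.bConst_nonneg hα _
  refine ⟨fun μ _ hμ hfin T hT hkl η hη => ?_, fun ν _ hν η hη => ?_⟩
  · have hη0 : 0 ≤ η := by
      have h1 := Real.log_nonneg (HypoUQ.one_le_toReal_densityNorm hμ hfin)
      have h2 := hip.log_inv_nonneg
      rw [hη]
      positivity
    have h1 : s * ((∫ ω, HypoUQ.timeAverage X' f T ω ∂P') - ∫ x, f x ∂μs) ≤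
        √(2 * v * η) + b * η := by
      refine HypoUQ.le_sqrt_add_mul_of_forall hv0 hb0 hη0 fun l hl hlb => ?_
      subst hv hb hη
      exact hip.timeAverage_sub_le hinv P' X' hX'm hX' hf hfb s hμ hfin hT hkl hl hlb
    have h2 := hip.bias_le hinv hf hfb hs hμ hfin hT
    linarith
  · refine HypoUQ.le_sqrt_add_mul_of_forall hv0 hb0 η.coe_nonneg fun l hl hlb => ?_
    obtain ⟨K, hK⟩ := hfb
    -- Along integer times, convergence in probability yields an almost surely convergent
    -- subsequence; boundedness of `f` then gives convergence of expectations.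
    have hmeas := (hν f hf ⟨K, hK⟩).comp tendsto_natCast_atTop_atTop
    obtain ⟨ns, hns, hae⟩ := hmeas.exists_seq_tendsto_ae
    have hnsT : Tendsto (fun n => ((ns n : ℕ) : ℝ≥0)) atTop atTop :=
      tendsto_natCast_atTop_atTop.comp hns.tendsto_atTop
    have hpos : ∀ᶠ n in atTop, 0 < ((ns n : ℕ) : ℝ≥0) := hnsT.eventually_gt_atTop 0
    have hE : Tendsto (fun n => ∫ ω, HypoUQ.timeAverage X' f (ns n : ℕ) ω ∂P') atTop
        (𝓝 (∫ x, f x ∂ν)) := by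
      have := tendsto_integral_filter_of_dominated_convergence (μ := P') (fun _ => K)
        (F := fun n ω => HypoUQ.timeAverage X' f (ns n : ℕ) ω)
        (.of_forall fun n =>
          (HypoUQ.measurable_timeAverage hX'm hX' hf _).aestronglyMeasurable)
        (hpos.mono fun n hn => .of_forall (HypoUQ.abs_timeAverage_le hK hn))
        (integrable_const K) hae
      simpa using this
    have hkl := hη.comp hnsT
    have hkltop : ∀ᶠ n in atTop, InformationTheory.klDiv (HypoUQ.pathLaw P' X' hX' (ns n : ℕ))
        (HypoUQ.pathLaw (M.law μs) M.X M.cadlag (ns n : ℕ)) ≠ ∞ := by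
      -- An infinite entropy divided by a finite `T` is infinite, which the finite limit excludes
      -- for large times.
      filter_upwards [hkl.eventually_lt_const ENNReal.coe_lt_top] with n hn htop
      simp [htop, ENNReal.top_div] at hn
    have hklr := (ENNReal.tendsto_toReal ENNReal.coe_ne_top).comp hkl
    -- With `μ = μs` the density norm is `1`, so `log c⁻¹` is the only term besides the entropy, and
    -- division by `T` removes it.
    have hinvn : Tendsto (fun n => Real.log c⁻¹ / ((ns n : ℕ) : ℝ)) atTop (𝓝 0) :=
      tendsto_const_nhds.div_atTop (tendsto_natCast_atTop_atTop.comp hns.tendsto_atTop)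
    have hrhs := (tendsto_const_nhds (x := l * v / (2 * (1 - l * b)))).add
      ((hinvn.add hklr).div_const l)
    rw [zero_add, ENNReal.coe_toReal] at hrhs
    refine le_of_tendsto_of_tendsto ((hE.sub_const _).const_mul s) hrhs ?_
    filter_upwards [hpos, hkltop] with n hn htop
    have h := hip.timeAverage_sub_le hinv P' X' hX'm hX' hf ⟨K, hK⟩ s
      (Measure.AbsolutelyContinuous.refl μs) (by simp [HypoUQ.densityNorm_self]) hn htop hl
      (hb ▸ hlb)
    rw [← hv, ← hb, HypoUQ.densityNorm_self] at h
    refine h.trans_eq ?_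
    simp only [ENNReal.toReal_one, Real.log_one, Function.comp_apply, ENNReal.toReal_div,
      ENNReal.coe_toReal, NNReal.coe_natCast]
    ring
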